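/- Let $p$ be an odd prime, let $k>1$ be an integer and let $0\le j\le k$. For $\tau$ in the upper half plane $\mathbb H$ put $q=e^{2\pi i\tau}$, $$\varphi(\tau)=\sum_{n\in\mathbb Z}q^{n^2},\qquad z_a=z_a(\tau)=\varphi(a\tau)^2,\qquad z=z_1 .$$ Let $\chi_{-4}(n)=\left(\frac{-4}{n}\right)$ be the nontrivial character modulo $4$ and $p_\chi=\chi_{-4}(p)\,p$. Define $B_n$ and $B_{n,\chi_{-4}}$ by $\sum_{n\ge0}\frac{B_n}{n!}x^n=\frac{x}{e^x-1}$ and $\sum_{n\ge0}\frac{B_{n,\chi_{-4}}}{n!}x^n=\sum_{a=1}^4\frac{\chi_{-4}(a)\,x e^{ax}}{e^{4x}-1}$. For even $k$ let $$E_k(\tau)=1-\frac{2k}{B_k}\sum_{n\ge1}\Big(\sum_{d\mid n}d^{k-1}\Big)q^n ,$$ and for odd $k$ let $$E_k^{(1)}(\tau)=-\frac{2k}{B_{k,\chi_{-4}}}\sum_{n\ge1}\Big(\sum_{d\mid n}\chi_{-4}(n/d)\,d^{k-1}\Big)q^n,\qquad E_k^{(2)}(\tau)=1-\frac{2k}{B_{k,\chi_{-4}}}\sum_{n\ge1}\Big(\sum_{d\mid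 n}\chi_{-4}(d)\,d^{k-1}\Big)q^n .$$ For $a\in\{1,p\}$ define $F_p(k,j;a\tau)$, if $k$ is even, by $$F_p(k,j;a\tau)=\frac{\chi_{-4}(p)^j}{2^k-1}\Big((-1)^{k/2}E_k(a\tau)-\big((-1)^{k/2}+\chi_{-4}(p)^j\big)E_k(2a\tau)+\chi_{-4}(p)^j\,2^kE_k(4a\tau)\Big),$$ and, if $k$ is odd, by $$F_p(k,j;a\tau)=E_k^{(2)}(a\tau)+\chi_{-4}(a)\,\chi_{-4}(p)^j\,(-4)^{(k-1)/2}E_k^{(1)}(a\tau).$$ (For odd $k$ the factor $\chi_{-4}(a)$ is part of the notation $F_p(k,j;a\tau)$.) Then there exists a modular function $A_p(k,j;\tau)$ of weight $0$ for $\Gamma_0(4p)$, that is, a $\Gamma_0(4p)$-invariant meromorphic function on $\mathbb H$ that is meromorphic at all cusps, such that on $\mathbb H$ $$z^{k-j}z_p^{\,j}=\frac{p_\chi^{k-j}-1}{p_\chi^{k}-1}\,F_p(k,j;\tau)+\frac{p_\chi^{k}-p_\chi^{k-j}}{p_\chi^{k}-1}\,F_p(k,j;p\tau)+z^kA_p(k,j;\tau),$$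 and such that $z^kA_p(k,j;\tau)$ is a cusp form of weight $k$ for $\Gamma_0(4p)$, with trivial character if $k$ is even and with character $\chi_{-4}$ if $k$ is odd. Moreover, if $N(1^{2k-2j},p^{2j};n)$ denotes the number of representations of $n$ by the quadratic form $x_1^2+\dots+x_{2k-2j}^2+p\,(y_1^2+\dots+y_{2j}^2)$ with integer variables, then $\sum_{n\ge0}N(1^{2k-2j},p^{2j};n)\,q^n=z^{k-j}z_p^{\,j}$, so the identity above expresses these numbers through the coefficients of its right-hand side. -/

import Mathlib

open UpperHalfPlane
open scoped ModularForm MatrixGroups Manifold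

namespace RamanujanMordell

noncomputable section

/-- The character `χ_{-4}`, `n ↦ (-4 / n)`, as an integer-valued function of `n`. -/
def chi (n : ℕ) : ℤ := ZMod.χ₄ (n : ZMod 4)

/-- `p_χ = χ_{-4}(p) p`. -/
def pChi (p : ℕ) : ℂ := (chi p : ℂ) * (p : ℂ)

/-- `χ_{-4}` as a complex Dirichlet character modulo `4`. -/
def chiNegFour : DirichletCharacter ℂ 4 := ZMod.χ₄.ringHomComp (Int.castRingHom ℂ)

/-- The nome `q = e^{2 π i τ}`. -/
def nome (τ : ℂ) : ℂ := Complex.exp (2 * (Real.pi : ℂ) * Complex.I * τ)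

/-! ### Theta functions and representation numbers -/

/-- Ramanujan's theta function `φ(τ) = ∑_{n ∈ ℤ} q^{n²}`. -/
def phi (τ : ℂ) : ℂ := ∑' n : ℤ, nome τ ^ (n ^ 2)

/-- `z_a(τ) = φ(aτ)²`. -/
def z (a : ℕ) (τ : ℂ) : ℂ := phi ((a : ℂ) * τ) ^ 2

/-- `N(1^r, p^s; n)`: the number of representations of `n` by
`x_1² + ⋯ + x_r² + p (y_1² + ⋯ + y_s²)` with integers `x_i`, `y_i`. -/
def repNumber (p r s n : ℕ) : ℕ :=
  Nat.card {v : (Fin r → ℤ) × (Fin s → ℤ) //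
    (∑ i, v.1 i ^ 2) + (p : ℤ) * (∑ i, v.2 i ^ 2) = (n : ℤ)}

/-! ### Generalized Bernoulli numbers attached to `χ_{-4}` -/

/-- The power series `(e^{4x} - 1) / x`. -/
def expFourSubOneDivX : PowerSeries ℚ :=
  PowerSeries.mk fun n => (4 : ℚ) ^ (n + 1) / ((n + 1).factorial : ℚ)

/-- The generating function `∑_{a=1}^{4} χ_{-4}(a) x e^{ax} / (e^{4x} - 1)`. -/
def bernoulliChiSeries : PowerSeries ℚ :=
  ∑ a ∈ Finset.Icc 1 4, (chi a : ℚ) •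
    (PowerSeries.rescale (a : ℚ) (PowerSeries.exp ℚ) * expFourSubOneDivX⁻¹)

/-- `B_{n,χ_{-4}}`, i.e. `n!` times the coefficient of `x^n` in the generating function. -/
def bernoulliChi (n : ℕ) : ℚ := (n.factorial : ℚ) * PowerSeries.coeff n bernoulliChiSeries

theorem X_mul_expFourSubOneDivX :
    PowerSeries.X * expFourSubOneDivX =
      PowerSeries.rescale (4 : ℚ) (PowerSeries.exp ℚ) - 1 := by
  ext n
  cases n with
  | zero =>
    rw [PowerSeries.coeff_zero_X_mul, map_sub, PowerSeries.coeff_rescale,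
      PowerSeries.coeff_exp, PowerSeries.coeff_one]
    simp
  | succ n =>
    simp [PowerSeries.coeff_succ_X_mul, expFourSubOneDivX, PowerSeries.coeff_rescale,
      PowerSeries.coeff_exp, PowerSeries.coeff_one, div_eq_mul_inv]

/-- The defining relation of the generating function, with the denominator cleared. -/
theorem bernoulliChiSeries_mul :
    bernoulliChiSeries * (PowerSeries.rescale (4 : ℚ) (PowerSeries.exp ℚ) - 1) =
      ∑ a ∈ Finset.Icc 1 4, (chi a : ℚ) •
        (PowerSeries.X * PowerSeries.rescale (a : ℚ) (PowerSeries.exp ℚ)) := by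
  have h : expFourSubOneDivX⁻¹ * expFourSubOneDivX = 1 :=
    PowerSeries.inv_mul_cancel _ (by
      simp [expFourSubOneDivX, ← PowerSeries.coeff_zero_eq_constantCoeff_apply])
  rw [← X_mul_expFourSubOneDivX, bernoulliChiSeries, Finset.sum_mul]
  refine Finset.sum_congr rfl fun a _ => ?_
  rw [smul_mul_assoc]
  congr 1
  calc _ = PowerSeries.X * PowerSeries.rescale (a : ℚ) (PowerSeries.exp ℚ) *
        (expFourSubOneDivX⁻¹ * expFourSubOneDivX) := by ring
    _ = _ := by rw [h, mul_one]

/-! ### Eisenstein series -/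

/-- `E_k(τ) = 1 - (2k / B_k) ∑_{n ≥ 1} σ_{k-1}(n) q^n` (used for even `k`). -/
def eisE (k : ℕ) (τ : ℂ) : ℂ :=
  1 - 2 * (k : ℂ) / ((bernoulli k : ℚ) : ℂ) *
    ∑' n : ℕ+, (∑ d ∈ (n : ℕ).divisors, (d : ℂ) ^ (k - 1)) * nome τ ^ (n : ℕ)

/-- `E_k^{(1)}(τ) = -(2k / B_{k,χ_{-4}}) ∑_{n ≥ 1} (∑_{d ∣ n} χ_{-4}(n/d) d^{k-1}) q^n`
(used for odd `k`). -/
def eisE1 (k : ℕ) (τ : ℂ) : ℂ :=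
  -(2 * (k : ℂ) / (bernoulliChi k : ℂ)) *
    ∑' n : ℕ+, (∑ d ∈ (n : ℕ).divisors, (chi ((n : ℕ) / d) : ℂ) * (d : ℂ) ^ (k - 1)) *
      nome τ ^ (n : ℕ)

/-- `E_k^{(2)}(τ) = 1 - (2k / B_{k,χ_{-4}}) ∑_{n ≥ 1} (∑_{d ∣ n} χ_{-4}(d) d^{k-1}) q^n`
(used for odd `k`). -/
def eisE2 (k : ℕ) (τ : ℂ) : ℂ :=
  1 - 2 * (k : ℂ) / (bernoulliChi k : ℂ) *
    ∑' n : ℕ+, (∑ d ∈ (n : ℕ).divisors, (chi d : ℂ) * (d : ℂ) ^ (k - 1)) *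
      nome τ ^ (n : ℕ)

/-- `F_p(k, j; aτ)`, for `a ∈ {1, p}`. For odd `k` the symbol `F_p(k, j; aτ)` carries the factor
`χ_{-4}(a)` in its second term, hence it depends on `a` and not only on the number `aτ`. -/
def F (p k j a : ℕ) (τ : ℂ) : ℂ :=
  if Even k then
    (chi p : ℂ) ^ j / ((2 : ℂ) ^ k - 1) *
      ((-1) ^ (k / 2) * eisE k ((a : ℂ) * τ)
        - ((-1) ^ (k / 2) + (chi p : ℂ) ^ j) * eisE k (2 * ((a : ℂ) * τ))
        + (chi p : ℂ) ^ j * 2 ^ k * eisE k (4 * ((a : ℂ) * τ)))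
  else
    eisE2 k ((a : ℂ) * τ)
      + (chi a : ℂ) * (chi p : ℂ) ^ j * (-4) ^ ((k - 1) / 2) * eisE1 k ((a : ℂ) * τ)

/-! ### Modular functions and cusp forms with character -/

/-- `f` is a modular function (of weight `0`) for `Γ₀(N)`: a meromorphic function on `ℍ`,
invariant under `Γ₀(N)` and meromorphic at every cusp. A meromorphic function is represented by
the function `ℍ → ℂ` that takes the value `0` at the poles. Meromorphy at the cusp `γ∞` means that
`f(γτ)`, for `Im τ` large, is a function of `e^{2πiτ/h}` which is meromorphic at `0`. -/
structure IsModularFunction (N : ℕ) (f : ℍ → ℂ) : Prop where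
  meromorphic : ∀ τ : ℍ, MeromorphicNFAt (f ∘ ofComplex) (τ : ℂ)
  invariant : ∀ γ ∈ CongruenceSubgroup.Gamma0 N, ∀ τ : ℍ, f (γ • τ) = f τ
  meromorphic_cusps : ∀ γ : SL(2, ℤ), ∃ h : ℕ, 0 < h ∧ ∃ g : ℂ → ℂ, MeromorphicAt g 0 ∧
    ∀ᶠ τ : ℍ in atImInfty, f (γ • τ) = g (nome ((τ : ℂ) / (h : ℂ)))

/-- `f ∈ S_k(Γ₀(N), χ)`: `f` is holomorphic on `ℍ`,
`f((aτ + b)/(cτ + d)) = χ(d) (cτ + d)^k f(τ)` on `Γ₀(N)`, and `f` vanishes at every cusp. -/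
structure IsCuspForm (N : ℕ) (χ : DirichletCharacter ℂ N) (k : ℕ) (f : ℍ → ℂ) : Prop where
  holo : MDiff f
  slash_eq : ∀ γ ∈ CongruenceSubgroup.Gamma0 N,
    f ∣[(k : ℤ)] γ = χ ((γ 1 1 : ℤ) : ZMod N) • f
  zero_at_cusps : ∀ γ : SL(2, ℤ), IsZeroAtImInfty (f ∣[(k : ℤ)] γ)

/-- The character `χ_{-4}^k` modulo `4p`: the principal character for even `k`, and the character
induced by `χ_{-4}` for odd `k`. -/
def levelChar (p k : ℕ) : DirichletCharacter ℂ (4 * p) :=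
  DirichletCharacter.changeLevel (Nat.dvd_mul_right 4 p) chiNegFour ^ k

end

end RamanujanMordell

/-!
The function `z^{k-j} z_p^j` is a modular form of weight `k` for `Γ₀(4p)` with character `χ_{-4}^k`,
and so is the combination of Eisenstein series on the right-hand side. The two forms have the same
value at every cusp, hence their difference `f` is a cusp form. As theta constants have no zeros on
the upper half plane, `A = f / z^k` is holomorphic there, and it is a modular function of weight `0`.

The behaviour of `z` is read off from Jacobi's theta constants. For `(c, d)` the bottom row of a
matrix `γ`, the image of `z` under the weight one action of `γ` is the function `thetaRow c d`, which
involves only the residues of `c` and `d` modulo `4` (`z_one_slash`). Thus `z` has character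
`χ_{-4}`, the value `1` at `∞`, the value `-i/2` at `0`, and it vanishes at `1/2`; the values at all
cusps `γ ∞` follow. This is the content of the predicate `LevelFour`, which records the
transformation law and the limits at all cusps for a form of level four that vanishes at `1/2`.
Nonvanishing (`jacobiTheta_ne_zero`) holds because `SL(2, ℤ)` permutes the three even theta constants
up to nonvanishing factors, and on the fundamental domain each of them is dominated by its leading
term.

The functions `F_p(k, j; τ)` are Eisenstein series that also satisfy `LevelFour`, with the values `1`
and `± (-i/2)^k` at `∞` and `0`. For even `k` they are combinations of `E_k(τ)`, `E_k(2τ)`, `E_k(4τ)`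
(`levelFour_evenEis`); in weight two `E_2` is replaced by its nonholomorphic completion `eisEStar`,
and the nonholomorphic terms cancel in the sum over `a ∈ {1, p}` (`coeff_weight_two`). For odd `k` the
series `E_k^{(1)}` and `E_k^{(2)}` are, up to constant factors, the lattice sums
`∑ χ_{-4}(c) (cτ + d)^{-k}` and `∑ χ_{-4}(d) (4cτ + d)^{-k}`, whose transformation laws and limits are immediate
(`levelFour_eisZero`, `levelFour_eisInfty`). The Fourier expansions come from Lipschitz' formula, and
the normalizations agree by the evaluation of `L(k, χ_{-4})` in terms of `B_{k, χ_{-4}}`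
(`chiSum_mul`).

Replacing `τ` by `pτ` changes the values at the cusps in a controlled way
(`LevelFour.tendsto_dilate_prime`): the result depends on whether `p` divides the denominator of the
cusp. Equality of the values at all cusps then reduces to the two relations `coeffOne_add_coeffP` and
`coeffOne_add_coeffP_mul` between the coefficients (`cuspVal_eq`).

The generating function identity is the multiplication of absolutely convergent series
(`hasSum_repNumber`).
-/

namespace RamanujanMordell

open Filter Topology

/-! ### Theta functions -/

/-- The theta constant `θ₂(σ) = ∑_{n ∈ ℤ} e^{πi(n+1/2)²σ}`; in this notation `jacobiTheta` is `θ₃`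
and `θ₄(σ) = θ₃(σ + 1)`. -/
noncomputable def thetaTwo (σ : ℂ) : ℂ :=
  Complex.exp (Real.pi * Complex.I * σ / 4) * jacobiTheta₂ (σ / 2) σ

theorem ne_zero_of_im_pos {σ : ℂ} (h : 0 < σ.im) : σ ≠ 0 := by
  rintro rfl; simp at h

theorem neg_one_div_im_pos {σ : ℂ} (h : 0 < σ.im) : 0 < (-1 / σ).im := by
  have := (ModularGroup.S • (⟨σ, h⟩ : ℍ)).im_pos
  rw [modular_S_smul] at this
  simpa [neg_div, inv_neg, one_div] using this

theorem cpow_half_sq (w : ℂ) : (w ^ (1 / 2 : ℂ)) ^ 2 = w := by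
  rw [← Complex.cpow_nat_mul]; norm_num

theorem jacobiTheta_neg_one_div_sq {σ : ℂ} (h : 0 < σ.im) :
    jacobiTheta (-1 / σ) ^ 2 = -Complex.I * σ * jacobiTheta σ ^ 2 := by
  have := jacobiTheta_S_smul ⟨σ, h⟩
  rw [modular_S_smul] at this
  simp only at this
  rw [show -1 / σ = (-σ)⁻¹ by rw [inv_neg, neg_div, one_div], this, mul_pow, cpow_half_sq]

theorem jacobiTheta_add_two_mul_int (σ : ℂ) (n : ℤ) :
    jacobiTheta (σ + 2 * n) = jacobiTheta σ := by
  have h : Function.Periodic jacobiTheta 2 := fun x => by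
    rw [add_comm, jacobiTheta_two_add]
  have := h.int_mul n σ
  rwa [mul_comm] at this

theorem jacobiTheta_add_one (σ : ℂ) : jacobiTheta (σ + 1) = jacobiTheta₂ (1 / 2) σ := by
  refine tsum_congr fun n => ?_
  obtain ⟨m, hm⟩ : Even (n ^ 2 - n) := by
    rw [show n ^ 2 - n = (n - 1) * (n - 1 + 1) by ring]
    exact Int.even_mul_succ_self _
  have hm' : (n : ℂ) ^ 2 = n + 2 * m := by
    have : n ^ 2 = n + 2 * m := by linarith
    exact_mod_cast this
  rw [jacobiTheta₂_term, Complex.exp_eq_exp_iff_exists_int]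
  exact ⟨m, by linear_combination (Real.pi * Complex.I) * hm'⟩

theorem thetaTwo_neg_one_div_sq {σ : ℂ} (h : 0 < σ.im) :
    thetaTwo (-1 / σ) ^ 2 = -Complex.I * σ * jacobiTheta (σ + 1) ^ 2 := by
  have h0 := ne_zero_of_im_pos h
  have key := jacobiTheta₂_functional_equation (1 / 2) σ
  have h1 : jacobiTheta₂ (-1 / σ / 2) (-1 / σ) = jacobiTheta₂ (1 / 2 / σ) (-1 / σ) := by
    rw [← jacobiTheta₂_neg_left]; congr 1; field_simp
  have h2 : (-Complex.I * σ) ^ (1 / 2 : ℂ) ≠ 0 := by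
    rw [Ne, Complex.cpow_eq_zero_iff, not_and_or]
    exact Or.inl <| mul_ne_zero (neg_ne_zero.mpr Complex.I_ne_zero) h0
  have h3 : thetaTwo (-1 / σ) = (-Complex.I * σ) ^ (1 / 2 : ℂ) * jacobiTheta (σ + 1) := by
    rw [jacobiTheta_add_one, key, thetaTwo, h1]
    rw [show (Real.pi * Complex.I * (-1 / σ) / 4 : ℂ)
      = -Real.pi * Complex.I * (1 / 2) ^ 2 / σ by field_simp; norm_num]
    field_simp
  rw [h3, mul_pow, cpow_half_sq]

theorem jacobiTheta_neg_one_div_add_one_sq {σ : ℂ} (h : 0 < σ.im) :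
    jacobiTheta (-1 / σ + 1) ^ 2 = -Complex.I * σ * thetaTwo σ ^ 2 := by
  have h0 := ne_zero_of_im_pos h
  have := thetaTwo_neg_one_div_sq (neg_one_div_im_pos h)
  rw [show -1 / (-1 / σ) = σ by field_simp] at this
  rw [this]
  field_simp
  simp

theorem thetaTwo_add_one (σ : ℂ) :
    thetaTwo (σ + 1) = Complex.exp (Real.pi * Complex.I / 4) * thetaTwo σ := by
  rw [thetaTwo, thetaTwo, ← mul_assoc, ← Complex.exp_add]
  congr 1
  · congr 1; ring
  · refine tsum_congr fun n => ?_
    obtain ⟨m, hm⟩ : Even (n * (n + 1)) := Int.even_mul_succ_self _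
    have hm' : (n : ℂ) * (n + 1) = 2 * m := by
      have : n * (n + 1) = 2 * m := by linarith
      exact_mod_cast this
    rw [jacobiTheta₂_term, jacobiTheta₂_term, Complex.exp_eq_exp_iff_exists_int]
    exact ⟨m, by linear_combination (Real.pi * Complex.I) * hm'⟩

theorem exp_pi_mul_I_div_four_pow_four : Complex.exp (Real.pi * Complex.I / 4) ^ 4 = -1 := by
  rw [← Complex.exp_nat_mul, ← Complex.exp_pi_mul_I]
  congr 1
  push_cast
  ring

theorem thetaTwo_add_two_sq (σ : ℂ) : thetaTwo (σ + 2) ^ 2 = -thetaTwo σ ^ 2 := by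
  rw [show σ + 2 = σ + 1 + 1 by ring, thetaTwo_add_one, thetaTwo_add_one]
  linear_combination thetaTwo σ ^ 2 * exp_pi_mul_I_div_four_pow_four

/-- `θ₂(σ) = 2 e^{πiσ/4} (1 + ε)`, where `|ε|` is bounded by a geometric series. -/
theorem norm_jacobiTheta₂_half_sub_two_le {σ : ℂ} (h : 0 < σ.im) :
    ‖jacobiTheta₂ (σ / 2) σ - 2‖ ≤
      2 * (Real.exp (-Real.pi * σ.im) / (1 - Real.exp (-Real.pi * σ.im))) := by
  have hy1 : Real.exp (-Real.pi * σ.im) < 1 :=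
    Real.exp_lt_one_iff.mpr (mul_neg_of_neg_of_pos (neg_lt_zero.mpr Real.pi_pos) h)
  have hy0 : 0 < Real.exp (-Real.pi * σ.im) := Real.exp_pos _
  have hs := hasSum_jacobiTheta₂_term (σ / 2) h
  let f : ℕ → ℂ := fun n => jacobiTheta₂_term (n : ℤ) (σ / 2) σ
  have h1 : Summable f := hs.summable.comp_injective (Nat.cast_injective (R := ℤ))
  have h2 : HasSum (fun n : ℕ => jacobiTheta₂_term (-((n : ℤ) + 1)) (σ / 2) σ) (∑' n, f n) := by
    convert! h1.hasSum using 2 with n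
    simp only [f, jacobiTheta₂_term]; congr 1; push_cast; ring
  have h3 := (HasSum.of_nat_of_neg_add_one (f := fun n : ℤ => jacobiTheta₂_term n (σ / 2) σ)
    h1.hasSum h2).unique hs
  have h4 : f 0 = 1 := by simp [f, jacobiTheta₂_term]
  rw [h1.tsum_eq_zero_add, h4] at h3
  have hb : ∀ n : ℕ, ‖f (n + 1)‖ ≤ Real.exp (-Real.pi * σ.im) ^ (n + 1) := by
    intro n
    simp only [f]
    rw [norm_jacobiTheta₂_term, ← Real.exp_nat_mul]
    apply Real.exp_le_exp.mpr
    have : (σ / 2).im = σ.im / 2 := by simp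
    rw [this]
    push_cast
    have : 0 ≤ Real.pi * σ.im * ((n : ℝ) + 1) * ((n : ℝ) + 1) := by
      have := Real.pi_pos; positivity
    linarith
  have s : HasSum (fun n : ℕ => Real.exp (-Real.pi * σ.im) ^ (n + 1))
      (Real.exp (-Real.pi * σ.im) / (1 - Real.exp (-Real.pi * σ.im))) := by
    simp_rw [pow_succ', div_eq_mul_inv]
    exact (hasSum_geometric_of_lt_one hy0.le hy1).mul_left _
  have h5 := tsum_of_norm_bounded s hb
  rw [← h3, show 1 + (∑' n, f (n + 1)) + (1 + ∑' n, f (n + 1)) - 2 = 2 * ∑' n, f (n + 1) by ring,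
    norm_mul, Complex.norm_two]
  gcongr

/-! ### The theta constants have no zeros -/

/-- The bound for the tails of the theta series at height at least `√3 / 2`, the lowest height in
the fundamental domain. -/
theorem exp_neg_pi_mul_div_lt_one {y : ℝ} (hy : 3 ≤ 4 * y ^ 2) (h0 : 0 < y) :
    2 * (Real.exp (-Real.pi * y) / (1 - Real.exp (-Real.pi * y))) < 1 := by
  have h1 : (0.8 : ℝ) < y := by nlinarith
  have h2 : 3 < Real.exp (Real.pi * y) := by
    have := Real.add_one_le_exp (Real.pi * y)
    nlinarith [Real.pi_gt_three]
  have h3 : Real.exp (-Real.pi * y) < 1 / 3 := by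
    rw [neg_mul, Real.exp_neg, ← one_div]
    exact one_div_lt_one_div_of_lt (by norm_num) h2
  rw [← mul_div_assoc, div_lt_one (by linarith)]
  linarith

/-- None of the three even theta constants vanishes at `τ`. This condition is invariant under
`SL(2, ℤ)`, which permutes the theta constants up to nowhere vanishing factors. -/
def ThetaNonvanishing (τ : ℍ) : Prop :=
  jacobiTheta τ ≠ 0 ∧ jacobiTheta (τ + 1) ≠ 0 ∧ thetaTwo τ ≠ 0

theorem thetaNonvanishing_of_im {τ : ℍ} (h : 3 ≤ 4 * τ.im ^ 2) : ThetaNonvanishing τ := by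
  have key : ∀ σ : ℂ, σ.im = τ.im → jacobiTheta σ ≠ 0 := by
    intro σ hσ h0
    have h1 := norm_jacobiTheta_sub_one_le (τ := σ) (by rw [hσ]; exact τ.im_pos)
    have h2 := exp_neg_pi_mul_div_lt_one h τ.im_pos
    rw [h0, hσ, div_mul_eq_mul_div, mul_div_assoc] at h1
    simp only [zero_sub, norm_neg, norm_one] at h1
    linarith
  refine ⟨key _ rfl, key _ (by simp), mul_ne_zero (Complex.exp_ne_zero _) fun h0 => ?_⟩
  have h1 := norm_jacobiTheta₂_half_sub_two_le (σ := (τ : ℂ)) τ.im_pos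
  have h2 := exp_neg_pi_mul_div_lt_one h τ.im_pos
  rw [h0, zero_sub, norm_neg, Complex.norm_two, coe_im] at h1
  linarith

theorem coe_S_smul (τ : ℍ) : ((ModularGroup.S • τ : ℍ) : ℂ) = -1 / τ := by
  rw [modular_S_smul]
  simp [inv_neg, neg_div]

theorem coe_T_smul (τ : ℍ) : ((ModularGroup.T • τ : ℍ) : ℂ) = τ + 1 := by
  rw [modular_T_smul]
  simp [add_comm]

theorem thetaNonvanishing_S_smul (τ : ℍ) :
    ThetaNonvanishing (ModularGroup.S • τ) ↔ ThetaNonvanishing τ := by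
  have h0 : -Complex.I * (τ : ℂ) ≠ 0 :=
    mul_ne_zero (neg_ne_zero.mpr Complex.I_ne_zero) τ.ne_zero
  have h1 := jacobiTheta_neg_one_div_sq (σ := τ) τ.im_pos
  have h2 := jacobiTheta_neg_one_div_add_one_sq (σ := τ) τ.im_pos
  have h3 := thetaTwo_neg_one_div_sq (σ := τ) τ.im_pos
  have aux : ∀ {a b : ℂ}, a ^ 2 = -Complex.I * τ * b ^ 2 → (a ≠ 0 ↔ b ≠ 0) := by
    intro a b h
    rw [← pow_ne_zero_iff two_ne_zero, h, ← pow_ne_zero_iff (a := b) two_ne_zero]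
    exact mul_ne_zero_iff_left h0
  rw [ThetaNonvanishing, ThetaNonvanishing, coe_S_smul, aux h1, aux h2, aux h3]
  tauto

theorem thetaNonvanishing_T_smul (τ : ℍ) :
    ThetaNonvanishing (ModularGroup.T • τ) ↔ ThetaNonvanishing τ := by
  have h1 : jacobiTheta ((τ : ℂ) + 1 + 1) = jacobiTheta τ := by
    have := jacobiTheta_add_two_mul_int τ 1
    rwa [show (τ : ℂ) + 2 * (1 : ℤ) = τ + 1 + 1 by push_cast; ring] at this
  rw [ThetaNonvanishing, ThetaNonvanishing, coe_T_smul, thetaTwo_add_one, h1,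
    mul_ne_zero_iff_left (Complex.exp_ne_zero _)]
  tauto

theorem thetaNonvanishing_smul (γ : SL(2, ℤ)) (τ : ℍ) :
    ThetaNonvanishing (γ • τ) ↔ ThetaNonvanishing τ := by
  have hγ : γ ∈ Subgroup.closure {ModularGroup.S, ModularGroup.T} := by
    simp [SpecialLinearGroup.SL2Z_generators]
  induction hγ using Subgroup.closure_induction generalizing τ with
  | mem x hx =>
    rcases hx with rfl | rfl
    · exact thetaNonvanishing_S_smul τ
    · exact thetaNonvanishing_T_smul τ
  | one => simp
  | mul x y _ _ hx hy => rw [mul_smul]; exact (hx _).trans (hy _)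
  | inv x _ hx => simpa using (hx (x⁻¹ • τ)).symm

/-- The theta constants have no zeros: by `SL(2, ℤ)`-invariance it suffices to consider the
fundamental domain, where their leading terms dominate. -/
theorem thetaNonvanishing (τ : ℍ) : ThetaNonvanishing τ := by
  obtain ⟨γ, hγ⟩ := ModularGroup.exists_smul_mem_fd τ
  rw [← thetaNonvanishing_smul γ]
  exact thetaNonvanishing_of_im (ModularGroup.three_le_four_mul_im_sq_of_mem_fd hγ)

theorem jacobiTheta_ne_zero {σ : ℂ} (h : 0 < σ.im) : jacobiTheta σ ≠ 0 :=
  (thetaNonvanishing ⟨σ, h⟩).1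

/-! ### The theta function `φ` -/

theorem phi_eq_jacobiTheta (τ : ℂ) : phi τ = jacobiTheta (2 * τ) := by
  refine tsum_congr fun n => ?_
  rw [nome, ← Complex.exp_int_mul]
  congr 1
  push_cast
  ring

theorem z_eq_jacobiTheta (a : ℕ) (τ : ℂ) : z a τ = jacobiTheta (2 * (a * τ)) ^ 2 := by
  rw [z, phi_eq_jacobiTheta]

theorem z_ne_zero {a : ℕ} (ha : 0 < a) (τ : ℍ) : z a τ ≠ 0 := by
  rw [z_eq_jacobiTheta]
  refine pow_ne_zero _ (jacobiTheta_ne_zero ?_)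
  have := τ.im_pos
  have ha' : (0 : ℝ) < a := by exact_mod_cast ha
  simp only [Complex.mul_im, Complex.re_ofNat, Complex.im_ofNat, Complex.natCast_re,
    Complex.natCast_im, coe_im]
  simp
  positivity

/-! ### The action of `SL(2, ℤ)` on `φ²` -/

/-- `χ_{-4}` on the integers, with complex values. -/
noncomputable def chiInt (n : ℤ) : ℂ := ((ZMod.χ₄ (n : ZMod 4) : ℤ) : ℂ)

theorem chiInt_mod_four (n : ℤ) : chiInt (n % 4) = chiInt n := by
  rw [chiInt, chiInt, ZMod.χ₄_int_mod_four n]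

theorem chiInt_congr {m n : ℤ} (h : m % 4 = n % 4) : chiInt m = chiInt n := by
  rw [← chiInt_mod_four m, h, chiInt_mod_four]

theorem chiInt_of_zero {n : ℤ} (h : n % 4 = 0) : chiInt n = 0 := by
  rw [← chiInt_mod_four, h]; simp [chiInt]

theorem chiInt_of_one {n : ℤ} (h : n % 4 = 1) : chiInt n = 1 := by
  rw [← chiInt_mod_four, h]; simp [chiInt]

theorem chiInt_of_two {n : ℤ} (h : n % 4 = 2) : chiInt n = 0 := by
  rw [← chiInt_mod_four, h, chiInt, show ((2 : ℤ) : ZMod 4) = 2 by norm_cast,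
    show ZMod.χ₄ 2 = 0 by decide]; simp

theorem chiInt_of_three {n : ℤ} (h : n % 4 = 3) : chiInt n = -1 := by
  rw [← chiInt_mod_four, h, chiInt, show ((3 : ℤ) : ZMod 4) = 3 by norm_cast,
    show ZMod.χ₄ 3 = -1 by decide]; simp

theorem chiInt_mul (m n : ℤ) : chiInt (m * n) = chiInt m * chiInt n := by
  rw [chiInt, chiInt, chiInt, Int.cast_mul, map_mul, Int.cast_mul]

theorem chiInt_neg (n : ℤ) : chiInt (-n) = -chiInt n := by
  rw [← neg_one_mul, chiInt_mul, chiInt_of_three (n := -1) (by norm_num), neg_one_mul]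

theorem chiInt_sq {n : ℤ} (h : n % 2 = 1) : chiInt n ^ 2 = 1 := by
  have : n % 4 = 1 ∨ n % 4 = 3 := by omega
  rcases this with h | h
  · rw [chiInt_of_one h]; norm_num
  · rw [chiInt_of_three h]; norm_num

theorem chi_eq_chiInt (n : ℕ) : (chi n : ℂ) = chiInt n := by
  simp [chi, chiInt]

theorem jacobiTheta_half_congr {m n : ℤ} (h : m % 4 = n % 4) (τ : ℂ) :
    jacobiTheta ((τ + m) / 2) = jacobiTheta ((τ + n) / 2) := by
  obtain ⟨l, rfl⟩ : ∃ l, m = n + 4 * l := ⟨(m - n) / 4, by omega⟩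
  rw [← jacobiTheta_add_two_mul_int ((τ + n) / 2) l]
  congr 1
  push_cast
  ring

/-- The image of `φ²` under the weight one action of a matrix in `SL(2, ℤ)` with bottom row
`(c, d)`. It depends only on `(c, d)` modulo `4`. -/
noncomputable def thetaRow (c d : ℤ) (τ : ℍ) : ℂ :=
  if c % 4 = 0 then chiInt d * jacobiTheta (2 * τ) ^ 2
  else if c % 4 = 2 then chiInt d * thetaTwo (2 * τ) ^ 2
  else chiInt c * (-Complex.I / 2) * jacobiTheta ((τ + (c * d : ℤ)) / 2) ^ 2

theorem thetaRow_of_zero {c : ℤ} (hc : c % 4 = 0) (d : ℤ) (τ : ℍ) :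
    thetaRow c d τ = chiInt d * jacobiTheta (2 * τ) ^ 2 := if_pos hc

theorem thetaRow_of_two {c : ℤ} (hc : c % 4 = 2) (d : ℤ) (τ : ℍ) :
    thetaRow c d τ = chiInt d * thetaTwo (2 * τ) ^ 2 := by
  rw [thetaRow, if_neg (by omega), if_pos hc]

theorem thetaRow_of_odd {c : ℤ} (hc : c % 2 = 1) {d s : ℤ} (hs : (c * d) % 4 = s % 4) (τ : ℍ) :
    thetaRow c d τ = chiInt c * (-Complex.I / 2) * jacobiTheta ((τ + s) / 2) ^ 2 := by
  rw [thetaRow, if_neg (by omega), if_neg (by omega), jacobiTheta_half_congr hs]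

theorem thetaRow_slash_T (c d : ℤ) :
    thetaRow c d ∣[(1 : ℤ)] ModularGroup.T = thetaRow c (c + d) := by
  ext τ
  have hden : denom ModularGroup.T τ = 1 := by
    rw [ModularGroup.denom_apply]; simp [ModularGroup.T]
  rw [ModularForm.SL_slash_apply, hden, one_zpow, mul_one]
  have h : c % 4 = 0 ∨ c % 4 = 2 ∨ c % 2 = 1 := by omega
  rcases h with h | h | h
  · rw [thetaRow_of_zero h, thetaRow_of_zero h, coe_T_smul,
      chiInt_congr (show (c + d) % 4 = d % 4 by omega), mul_add,
      show (2 : ℂ) * 1 = 2 * (1 : ℤ) by norm_num, jacobiTheta_add_two_mul_int]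
  · rw [thetaRow_of_two h, thetaRow_of_two h, coe_T_smul, mul_add, mul_one, thetaTwo_add_two_sq]
    have h' : d % 2 = 0 ∨ d % 4 = 1 ∨ d % 4 = 3 := by omega
    rcases h' with h' | h' | h'
    · have : ∀ {n : ℤ}, n % 2 = 0 → chiInt n = 0 := fun {n} hn => by
        rcases (by omega : n % 4 = 0 ∨ n % 4 = 2) with h | h
        exacts [chiInt_of_zero h, chiInt_of_two h]
      rw [this h', this (by omega)]; simp
    · rw [chiInt_of_one h', chiInt_of_three (n := c + d) (by omega)]; ring
    · rw [chiInt_of_three h', chiInt_of_one (n := c + d) (by omega)]; ring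
  · have h1 : (c * (c + d)) % 4 = (1 + c * d) % 4 := by
      rw [mul_add, Int.add_emod, Int.add_emod 1]
      congr 2
      rcases (by omega : c % 4 = 1 ∨ c % 4 = 3) with h | h <;> simp [Int.mul_emod, h]
    rw [thetaRow_of_odd h rfl, thetaRow_of_odd h h1, coe_T_smul]
    push_cast
    ring_nf

theorem thetaRow_slash_S (c d : ℤ) :
    thetaRow c d ∣[(1 : ℤ)] ModularGroup.S = thetaRow d (-c) := by
  ext τ
  have hτ := τ.ne_zero
  have h2τ : 0 < (2 * (τ : ℂ)).im := by simpa using τ.im_pos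
  have hτ2 : 0 < ((τ : ℂ) / 2).im := by simpa using τ.im_pos
  have hI := Complex.I_mul_I
  rw [ModularForm.SL_slash_apply, ModularGroup.denom_S, zpow_neg_one]
  have e1 : (2 : ℂ) * (-1 / τ) = -1 / (τ / 2) := by field_simp
  have hc : c % 4 = 0 ∨ c % 4 = 2 ∨ c % 2 = 1 := by omega
  have hd : d % 4 = 0 ∨ d % 4 = 2 ∨ d % 2 = 1 := by omega
  have heven : ∀ {n : ℤ}, n % 4 = 0 ∨ n % 4 = 2 → chiInt n = 0 := fun {n} hn =>
    hn.elim chiInt_of_zero chiInt_of_two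
  rcases hc with hc | hc | hc
  · rw [thetaRow_of_zero hc, coe_S_smul, e1, jacobiTheta_neg_one_div_sq hτ2]
    rcases hd with hd | hd | hd
    · rw [thetaRow_of_zero hd, chiInt_of_zero hd, heven (n := -c) (by omega)]; simp
    · rw [thetaRow_of_two hd, chiInt_of_two hd, heven (n := -c) (by omega)]; simp
    · rw [thetaRow_of_odd hd (s := 0) (by rw [Int.mul_emod, show (-c) % 4 = 0 by omega]; simp)]
      simp only [Int.cast_zero, add_zero]
      field_simp
  · rw [thetaRow_of_two hc, coe_S_smul, e1, thetaTwo_neg_one_div_sq hτ2]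
    rcases hd with hd | hd | hd
    · rw [thetaRow_of_zero hd, chiInt_of_zero hd, heven (n := -c) (by omega)]; simp
    · rw [thetaRow_of_two hd, chiInt_of_two hd, heven (n := -c) (by omega)]; simp
    · rw [thetaRow_of_odd hd (s := 2) (by
        rw [Int.mul_emod, show (-c) % 4 = 2 by omega]; omega)]
      rw [show ((τ : ℂ) + (2 : ℤ)) / 2 = τ / 2 + 1 by push_cast; ring]
      field_simp
  · rcases hd with hd | hd | hd
    · rw [thetaRow_of_odd hc (s := 0) (by rw [Int.mul_emod, hd]; simp), thetaRow_of_zero hd,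
        coe_S_smul, chiInt_neg, Int.cast_zero, add_zero,
        show -1 / (τ : ℂ) / 2 = -1 / (2 * τ) by field_simp, jacobiTheta_neg_one_div_sq h2τ]
      field_simp
      linear_combination chiInt c * jacobiTheta (2 * τ) ^ 2 * hI
    · rw [thetaRow_of_odd hc (s := 2) (by rw [Int.mul_emod, hd]; omega), thetaRow_of_two hd,
        coe_S_smul, chiInt_neg,
        show (-1 / (τ : ℂ) + (2 : ℤ)) / 2 = -1 / (2 * τ) + 1 by push_cast; field_simp,
        jacobiTheta_neg_one_div_add_one_sq h2τ]
      field_simp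
      linear_combination chiInt c * thetaTwo (2 * τ) ^ 2 * hI
    · -- Both entries are odd, with product `s ≡ ±1`: here `S` acts on `(τ - s) / 2` as `S T⁻² S`.
      obtain ⟨s, hs, hcs⟩ : ∃ s : ℤ, (s = 1 ∨ s = -1) ∧ (c * d) % 4 = s % 4 := by
        have : (c * d) % 4 = 1 ∨ (c * d) % 4 = 3 := by
          rcases (by omega : c % 4 = 1 ∨ c % 4 = 3) with h | h <;>
          rcases (by omega : d % 4 = 1 ∨ d % 4 = 3) with h' | h' <;> simp [Int.mul_emod, h, h']
        rcases this with h | h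
        · exact ⟨1, Or.inl rfl, h⟩
        · exact ⟨-1, Or.inr rfl, h⟩
      have hsχ : chiInt s = s := by
        rcases hs with rfl | rfl
        · rw [chiInt_of_one (by norm_num)]; simp
        · rw [chiInt_of_three (by norm_num)]; simp
      have hs2 : (s : ℂ) ^ 2 = 1 := by rcases hs with rfl | rfl <;> norm_num
      have hχ : chiInt d = chiInt c * s := by
        rw [← hsχ, ← chiInt_congr hcs, chiInt_mul, ← mul_assoc, ← sq, chiInt_sq hc, one_mul]
      rw [thetaRow_of_odd hc hcs, thetaRow_of_odd hd (s := -s) (by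
        rw [mul_neg, mul_comm d c]; omega), coe_S_smul, hχ]
      have him : 0 < (((τ : ℂ) - s) / 2).im := by simpa using τ.im_pos
      obtain ⟨σ, hσ⟩ : ∃ σ : ℂ, σ = ((τ : ℂ) - s) / 2 := ⟨_, rfl⟩
      rw [← hσ] at him
      have hσ0 := ne_zero_of_im_pos him
      have hτσ : (τ : ℂ) = 2 * σ + s := by rw [hσ]; ring
      have him' : 0 < (-1 / σ + 2 * (-s : ℤ)).im := by
        rw [show (-1 / σ + 2 * (-s : ℤ)).im = (-1 / σ).im by simp]
        exact neg_one_div_im_pos him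
      have hX0 := ne_zero_of_im_pos him'
      have e2 : (-1 / (τ : ℂ) + s) / 2 = -1 / (-1 / σ + 2 * (-s : ℤ)) := by
        have hτσ' : 2 * σ + s ≠ 0 := hτσ ▸ hτ
        have h3 : 1 + 2 * s * σ ≠ 0 := by
          rw [show 1 + 2 * s * σ = s * (2 * σ + s) by linear_combination -hs2]
          refine mul_ne_zero (fun h => ?_) hτσ'
          rw [h] at hs2; norm_num at hs2
        rw [show -1 / σ + 2 * (-s : ℤ) = -(1 + 2 * s * σ) / σ by push_cast; field_simp; ring, hτσ,
          show -1 / (-(1 + 2 * s * σ) / σ) = σ / (1 + 2 * s * σ) by field_simp,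
          div_add' _ _ _ hτσ', div_div, div_eq_div_iff (mul_ne_zero hτσ' two_ne_zero) h3]
        linear_combination (4 * σ ^ 2 + 1 + 2 * s * σ) * hs2
      have e3 : (-1 / σ + 2 * (-s : ℤ)) * σ = -1 - 2 * s * σ := by push_cast; field_simp; ring
      rw [e2, jacobiTheta_neg_one_div_sq him', jacobiTheta_add_two_mul_int,
        jacobiTheta_neg_one_div_sq him,
        show ((τ : ℂ) + (-s : ℤ)) / 2 = σ by rw [hσ]; push_cast; ring]
      rw [show -Complex.I * (-1 / σ + 2 * (-s : ℤ)) * (-Complex.I * σ * jacobiTheta σ ^ 2) =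
        s * τ * jacobiTheta σ ^ 2 by
          linear_combination Complex.I * Complex.I * jacobiTheta σ ^ 2 * e3 +
            (-1 - 2 * s * σ) * jacobiTheta σ ^ 2 * hI - s * jacobiTheta σ ^ 2 * hτσ -
            jacobiTheta σ ^ 2 * hs2]
      field_simp

/-- The group `SL(2, ℤ)` permutes the functions `thetaRow c d` by acting on the row `(c, d)`. -/
theorem thetaRow_slash (c d : ℤ) (γ : SL(2, ℤ)) :
    thetaRow c d ∣[(1 : ℤ)] γ =
      thetaRow (c * γ 0 0 + d * γ 1 0) (c * γ 0 1 + d * γ 1 1) := by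
  have hγ : γ ∈ Subgroup.closure {ModularGroup.S, ModularGroup.T} := by
    simp [SpecialLinearGroup.SL2Z_generators]
  induction hγ using Subgroup.closure_induction generalizing c d with
  | mem x hx =>
    rcases hx with rfl | rfl
    · rw [thetaRow_slash_S]; simp [ModularGroup.S]
    · rw [thetaRow_slash_T]; simp [ModularGroup.T]
  | one => simp
  | mul x y _ _ hx hy =>
    rw [SlashAction.slash_mul, hx, hy]
    simp only [Matrix.SpecialLinearGroup.coe_mul, Matrix.mul_apply, Fin.sum_univ_two]
    ring_nf
  | inv x _ hx =>
    have hdet : x 0 0 * x 1 1 - x 0 1 * x 1 0 = 1 := by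
      rw [← Matrix.det_fin_two, x.det_coe]
    have h := hx (c * x⁻¹ 0 0 + d * x⁻¹ 1 0) (c * x⁻¹ 0 1 + d * x⁻¹ 1 1)
    have h00 : x⁻¹ 0 0 = x 1 1 := by simp [Matrix.SpecialLinearGroup.SL2_inv_expl]
    have h01 : x⁻¹ 0 1 = -x 0 1 := by simp [Matrix.SpecialLinearGroup.SL2_inv_expl]
    have h10 : x⁻¹ 1 0 = -x 1 0 := by simp [Matrix.SpecialLinearGroup.SL2_inv_expl]
    have h11 : x⁻¹ 1 1 = x 0 0 := by simp [Matrix.SpecialLinearGroup.SL2_inv_expl]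
    rw [h00, h01, h10, h11] at h ⊢
    rw [show (c * x 1 1 + d * -x 1 0) * x 0 0 + (c * -x 0 1 + d * x 0 0) * x 1 0 = c by
        linear_combination c * hdet,
      show (c * x 1 1 + d * -x 1 0) * x 0 1 + (c * -x 0 1 + d * x 0 0) * x 1 1 = d by
        linear_combination d * hdet] at h
    rw [← h, ← SlashAction.slash_mul, mul_inv_cancel, SlashAction.slash_one]

theorem z_one_eq_thetaRow : (fun τ : ℍ => z 1 τ) = thetaRow 0 1 := by
  ext τ
  rw [z_eq_jacobiTheta, thetaRow_of_zero (by norm_num), chiInt_of_one (by norm_num)]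
  simp

theorem z_one_slash (γ : SL(2, ℤ)) :
    (fun τ : ℍ => z 1 τ) ∣[(1 : ℤ)] γ = thetaRow (γ 1 0) (γ 1 1) := by
  rw [z_one_eq_thetaRow, thetaRow_slash]; simp

/-! ### Dilations of functions on the upper half plane -/

/-- The map `τ ↦ (α τ + β) / δ` on the upper half plane. -/
noncomputable def affine (α δ : ℕ+) (β : ℤ) (τ : ℍ) : ℍ :=
  ⟨(((α : ℕ) : ℂ) * τ + β) / ((δ : ℕ) : ℂ), by
    have h1 : (0 : ℝ) < (α : ℕ) := by exact_mod_cast α.pos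
    have h2 : (0 : ℝ) < (δ : ℕ) := by exact_mod_cast δ.pos
    have h3 := τ.im_pos
    rw [Complex.div_natCast_im]
    simp only [Complex.add_im, Complex.intCast_im, Complex.mul_im, Complex.natCast_re,
      Complex.natCast_im, coe_im]
    simp only [zero_mul, add_zero]
    positivity⟩

/-- The map `τ ↦ a τ` on the upper half plane. -/
noncomputable def dilate (a : ℕ+) (τ : ℍ) : ℍ := affine a 1 0 τ

theorem coe_affine (α δ : ℕ+) (β : ℤ) (τ : ℍ) :
    (affine α δ β τ : ℂ) = (((α : ℕ) : ℂ) * τ + β) / ((δ : ℕ) : ℂ) := rfl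

theorem coe_dilate (a : ℕ+) (τ : ℍ) : (dilate a τ : ℂ) = ((a : ℕ) : ℂ) * τ := by
  simp [dilate, coe_affine]

theorem affine_im (α δ : ℕ+) (β : ℤ) (τ : ℍ) :
    (affine α δ β τ).im = ((α : ℕ) : ℝ) * τ.im / ((δ : ℕ) : ℝ) := by
  rw [← coe_im, coe_affine, Complex.div_natCast_im]
  simp

theorem tendsto_affine (α δ : ℕ+) (β : ℤ) : Tendsto (affine α δ β) atImInfty atImInfty := by
  rw [atImInfty, tendsto_comap_iff]
  have h1 : (0 : ℝ) < (α : ℕ) := by exact_mod_cast α.pos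
  have h2 : (0 : ℝ) < (δ : ℕ) := by exact_mod_cast δ.pos
  simp only [Function.comp_def, affine_im]
  exact (tendsto_comap.const_mul_atTop h1).atTop_div_const h2

theorem coe_smul_eq (γ : SL(2, ℤ)) (τ : ℍ) :
    ((γ • τ : ℍ) : ℂ) = ((γ 0 0 : ℂ) * τ + γ 0 1) / ((γ 1 0 : ℂ) * τ + γ 1 1) := by
  rw [coe_specialLinearGroup_apply]; simp

theorem denom_eq (γ : SL(2, ℤ)) (τ : ℍ) : denom γ τ = (γ 1 0 : ℂ) * τ + γ 1 1 := by
  rw [ModularGroup.denom_apply]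

theorem det_eq_one (γ : SL(2, ℤ)) : γ 0 0 * γ 1 1 - γ 0 1 * γ 1 0 = 1 := by
  rw [← Matrix.det_fin_two, γ.det_coe]

/-- If `diag(a, 1) γ = γ₁ (α β; 0 δ)`, then `γ` maps `f(a τ)` to a multiple of
`(f ∣ γ₁)((α τ + β) / δ)`. -/
theorem slash_dilate (k : ℤ) (f : ℍ → ℂ) {a α δ : ℕ+} {β : ℤ} {γ γ₁ : SL(2, ℤ)}
    (h00 : (a : ℕ) * γ 0 0 = γ₁ 0 0 * (α : ℕ))
    (h01 : (a : ℕ) * γ 0 1 = γ₁ 0 0 * β + γ₁ 0 1 * (δ : ℕ))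
    (h10 : γ 1 0 = γ₁ 1 0 * (α : ℕ)) (h11 : γ 1 1 = γ₁ 1 0 * β + γ₁ 1 1 * (δ : ℕ)) (τ : ℍ) :
    ((fun τ => f (dilate a τ)) ∣[k] γ) τ =
      (((δ : ℕ) : ℂ) ^ k)⁻¹ * (f ∣[k] γ₁) (affine α δ β τ) := by
  have hδ : ((δ : ℕ) : ℂ) ≠ 0 := by exact_mod_cast δ.pos.ne'
  have hden : denom γ τ = ((δ : ℕ) : ℂ) * denom γ₁ (affine α δ β τ) := by
    rw [denom_eq, denom_eq, coe_affine, h10, h11]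
    push_cast
    field_simp
    ring
  have hpt : dilate a (γ • τ) = γ₁ • affine α δ β τ := by
    ext1
    have h1 := denom_ne_zero γ τ
    have h2 := denom_ne_zero γ₁ (affine α δ β τ)
    rw [coe_dilate, coe_smul_eq, coe_smul_eq, ← denom_eq, ← denom_eq, hden]
    rw [hden] at h1
    generalize denom γ₁ (affine α δ β τ) = D at h1 h2 ⊢
    rw [coe_affine]
    rw [← mul_div_assoc, div_eq_div_iff h1 h2]
    have e00 : ((a : ℕ) : ℂ) * γ 0 0 = γ₁ 0 0 * (α : ℕ) := by exact_mod_cast h00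
    have e01 : ((a : ℕ) : ℂ) * γ 0 1 = γ₁ 0 0 * β + γ₁ 0 1 * (δ : ℕ) := by exact_mod_cast h01
    have e3 : ((γ₁ 0 0 : ℂ) * ((((α : ℕ) : ℂ) * τ + β) / ((δ : ℕ) : ℂ)) + γ₁ 0 1) * ((δ : ℕ) : ℂ) =
        γ₁ 0 0 * (((α : ℕ) : ℂ) * τ + β) + γ₁ 0 1 * ((δ : ℕ) : ℂ) := by
      field_simp
    linear_combination D * (τ * e00 + e01 - e3)
  rw [ModularForm.SL_slash_apply, ModularForm.SL_slash_apply, hpt, hden, mul_zpow, zpow_neg,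
    zpow_neg]
  ring

/-- The action of `γ` on `f(aτ)`, for an arbitrary function `f`: the matrix `diag(a, 1) γ` is
written as `γ₁ (α β; 0 δ)` with `α = gcd(a, c)` and `αδ = a`, where `c` is the lower left entry
of `γ`. -/
theorem exists_slash_dilate (a : ℕ+) (γ : SL(2, ℤ)) :
    ∃ (α δ : ℕ+) (β : ℤ) (γ₁ : SL(2, ℤ)), (α : ℕ) = Int.gcd (a : ℕ) (γ 1 0) ∧ α * δ = a ∧
      γ₁ 0 0 = (δ : ℕ) * γ 0 0 ∧ γ 1 0 = γ₁ 1 0 * (α : ℕ) ∧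
      ∀ (k : ℤ) (f : ℍ → ℂ) (τ : ℍ), ((fun τ => f (dilate a τ)) ∣[k] γ) τ =
        (((δ : ℕ) : ℂ) ^ k)⁻¹ * (f ∣[k] γ₁) (affine α δ β τ) := by
  have hdet := det_eq_one γ
  have ha : ((a : ℕ) : ℤ) ≠ 0 := by exact_mod_cast a.pos.ne'
  have hg : 0 < Int.gcd (a : ℕ) (γ 1 0) := Int.gcd_pos_of_ne_zero_left _ ha
  obtain ⟨c, hc⟩ : (Int.gcd (a : ℕ) (γ 1 0) : ℤ) ∣ γ 1 0 := Int.gcd_dvd_right _ _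
  obtain ⟨δ, hδ⟩ : Int.gcd (a : ℕ) (γ 1 0) ∣ (a : ℕ) := by
    exact_mod_cast Int.gcd_dvd_left ((a : ℕ) : ℤ) (γ 1 0)
  set α := Int.gcd (a : ℕ) (γ 1 0) with hα
  have hδ0 : 0 < δ := Nat.pos_of_ne_zero (by rintro rfl; simp at hδ)
  -- `δ` and `c` are coprime because the common factor of `a` and `γ 1 0` has been removed.
  have hcop : IsCoprime (δ : ℤ) c := by
    obtain ⟨x, y, hxy⟩ : ∃ x y : ℤ, (α : ℤ) = (a : ℕ) * x + γ 1 0 * y :=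
      ⟨_, _, Int.gcd_eq_gcd_ab _ _⟩
    refine ⟨x, y, ?_⟩
    have : (α : ℤ) ≠ 0 := by exact_mod_cast hg.ne'
    apply mul_left_cancel₀ this
    have hδ' : ((a : ℕ) : ℤ) = α * δ := by exact_mod_cast hδ
    linear_combination -hxy - y * hc - x * hδ'
  have hcop2 : IsCoprime ((δ : ℤ) * γ 0 0) c := by
    refine IsCoprime.mul_left hcop ⟨γ 1 1, -γ 0 1 * α, ?_⟩
    linear_combination hdet + γ 0 1 * hc
  obtain ⟨v, u, huv⟩ := hcop2
  have hδ' : ((a : ℕ) : ℤ) = α * δ := by exact_mod_cast hδ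
  refine ⟨⟨α, hg⟩, ⟨δ, hδ0⟩, v * ((a : ℕ) * γ 0 1) + u * γ 1 1,
    ⟨!![δ * γ 0 0, -u; c, v], by rw [Matrix.det_fin_two_of]; linear_combination huv⟩,
    rfl, PNat.eq hδ.symm, rfl, by simpa [mul_comm] using hc, fun k f τ => ?_⟩
  apply slash_dilate
  · simp; linear_combination γ 0 0 * hδ'
  · simp
    linear_combination (-(a : ℕ) * γ 0 1) * huv - u * δ * hdet - (u * γ 0 1) * (δ * hc - c * hδ')
  · simpa [mul_comm] using hc
  · simp
    linear_combination (-γ 1 1) * huv + v * γ 0 1 * (δ * hc - c * hδ') + v * δ * hdet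

theorem tendsto_slash_dilate {k : ℤ} {f : ℍ → ℂ} {g : ℍ → ℂ} {α δ : ℕ+} {β : ℤ} {γ₁ : SL(2, ℤ)}
    {L : ℂ} (hg : ∀ τ, g τ = (((δ : ℕ) : ℂ) ^ k)⁻¹ * (f ∣[k] γ₁) (affine α δ β τ))
    (hf : Tendsto (f ∣[k] γ₁) atImInfty (𝓝 L)) :
    Tendsto g atImInfty (𝓝 ((((δ : ℕ) : ℂ) ^ k)⁻¹ * L)) := by
  rw [show g = fun τ => (((δ : ℕ) : ℂ) ^ k)⁻¹ * (f ∣[k] γ₁) (affine α δ β τ) from funext hg]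
  exact (hf.comp (tendsto_affine α δ β)).const_mul _

theorem mdifferentiable_of_differentiableOn {f : ℂ → ℂ}
    (h : DifferentiableOn ℂ f {w | 0 < w.im}) : MDiff (fun τ : ℍ => f τ) := by
  rw [mdifferentiable_iff]
  refine h.congr fun w hw => ?_
  simp [ofComplex_apply_of_im_pos hw]

/-! ### Behaviour at the cusps -/

/-- The value at the cusp `γ ∞` of a form of weight `k` and level `4` with character `χ_{-4}^k`,
which has the value `L∞` at `∞`, the value `L₀` at `0` and vanishes at `1/2`. -/
noncomputable def cuspVal (k : ℕ) (Linf L0 : ℂ) (γ : SL(2, ℤ)) : ℂ :=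
  if γ 1 0 % 4 = 0 then chiInt (γ 0 0) ^ k * Linf else chiInt (γ 1 0) ^ k * L0

theorem chiInt_zero_zero_eq {γ : SL(2, ℤ)} (h : γ 1 0 % 4 = 0) :
    chiInt (γ 0 0) = chiInt (γ 1 1) := by
  have hdet := det_eq_one γ
  have h1 : (γ 0 0 * γ 1 1) % 4 = 1 := by
    rw [show γ 0 0 * γ 1 1 = γ 0 1 * γ 1 0 + 1 by linarith, Int.add_emod, Int.mul_emod, h]
    simp
  have h3 : γ 0 0 % 4 = γ 1 1 % 4 := by
    rw [Int.mul_emod] at h1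
    have := Int.emod_nonneg (γ 0 0) (by norm_num : (4 : ℤ) ≠ 0)
    have := Int.emod_nonneg (γ 1 1) (by norm_num : (4 : ℤ) ≠ 0)
    have := Int.emod_lt_of_pos (γ 0 0) (by norm_num : (0 : ℤ) < 4)
    have := Int.emod_lt_of_pos (γ 1 1) (by norm_num : (0 : ℤ) < 4)
    generalize γ 0 0 % 4 = x at *
    generalize γ 1 1 % 4 = y at *
    interval_cases x <;> interval_cases y <;> simp_all
  exact chiInt_congr h3

theorem zero_zero_odd {γ : SL(2, ℤ)} (h : γ 1 0 % 2 = 0) : γ 0 0 % 2 = 1 := by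
  have hdet := det_eq_one γ
  by_contra h'
  have h1 : (γ 0 0 * γ 1 1) % 2 = 0 := by rw [Int.mul_emod, show γ 0 0 % 2 = 0 by omega]; simp
  have h2 : (γ 0 1 * γ 1 0) % 2 = 0 := by rw [Int.mul_emod, h]; simp
  omega

theorem tendsto_exp_neg_pi_im :
    Tendsto (fun y : ℝ => Real.exp (-Real.pi * y)) atTop (𝓝 0) := by
  refine Real.tendsto_exp_atBot.comp ?_
  exact tendsto_id.const_mul_atTop_of_neg (neg_lt_zero.mpr Real.pi_pos)

theorem tendsto_geometric_im :
    Tendsto (fun σ : ℂ => 2 * (Real.exp (-Real.pi * σ.im) / (1 - Real.exp (-Real.pi * σ.im))))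
      (comap Complex.im atTop) (𝓝 0) := by
  have h := tendsto_exp_neg_pi_im.comp (tendsto_comap (f := Complex.im))
  have h2 : Tendsto (fun y : ℝ => 2 * (y / (1 - y))) (𝓝 0) (𝓝 (2 * (0 / (1 - 0)))) := by
    refine Tendsto.const_mul _ (tendsto_id.div (tendsto_const_nhds.sub tendsto_id) (by norm_num))
  simp only [zero_div, mul_zero] at h2
  exact h2.comp h

theorem tendsto_jacobiTheta : Tendsto jacobiTheta (comap Complex.im atTop) (𝓝 1) := by
  rw [tendsto_iff_norm_sub_tendsto_zero]
  refine squeeze_zero' (Eventually.of_forall fun _ => norm_nonneg _) ?_ tendsto_geometric_im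
  filter_upwards [tendsto_comap.eventually (eventually_gt_atTop (0 : ℝ))] with σ hσ
  have := norm_jacobiTheta_sub_one_le hσ
  rwa [div_mul_eq_mul_div, mul_div_assoc] at this

theorem tendsto_thetaTwo : Tendsto thetaTwo (comap Complex.im atTop) (𝓝 0) := by
  have h1 : Tendsto (fun σ : ℂ => jacobiTheta₂ (σ / 2) σ) (comap Complex.im atTop) (𝓝 2) := by
    rw [tendsto_iff_norm_sub_tendsto_zero]
    refine squeeze_zero' (Eventually.of_forall fun _ => norm_nonneg _) ?_ tendsto_geometric_im
    filter_upwards [tendsto_comap.eventually (eventually_gt_atTop (0 : ℝ))] with σ hσ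
    exact norm_jacobiTheta₂_half_sub_two_le hσ
  have h2 : Tendsto (fun σ : ℂ => Complex.exp (Real.pi * Complex.I * σ / 4))
      (comap Complex.im atTop) (𝓝 0) := by
    rw [Complex.tendsto_exp_nhds_zero_iff]
    have : (fun σ : ℂ => (Real.pi * Complex.I * σ / 4).re) = fun σ => -(Real.pi / 4) * σ.im := by
      ext σ
      rw [show (Real.pi * Complex.I * σ / 4 : ℂ) = ((Real.pi / 4 : ℝ) : ℂ) * (Complex.I * σ) by
        push_cast; ring, Complex.re_ofReal_mul, Complex.I_mul_re]
      ring
    rw [this]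
    exact tendsto_comap.const_mul_atTop_of_neg (by have := Real.pi_pos; linarith)
  have h3 := h2.mul h1
  rw [zero_mul] at h3
  exact h3

theorem tendsto_im_affine (a b c : ℝ) (ha : 0 < a) :
    Tendsto (fun τ : ℍ => ((a : ℂ) * τ + (b : ℂ) : ℂ) + c) atImInfty (comap Complex.im atTop) := by
  rw [tendsto_comap_iff]
  have : (Complex.im ∘ fun τ : ℍ => ((a : ℂ) * τ + (b : ℂ) : ℂ) + c) = fun τ => a * τ.im := by
    ext τ; simp
  rw [this]
  exact tendsto_comap.const_mul_atTop ha

theorem tendsto_z_one_slash (γ : SL(2, ℤ)) :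
    Tendsto ((fun τ : ℍ => z 1 τ) ∣[(1 : ℤ)] γ) atImInfty
      (𝓝 (cuspVal 1 1 (-Complex.I / 2) γ)) := by
  rw [z_one_slash]
  have h2 : Tendsto (fun τ : ℍ => (2 * τ : ℂ)) atImInfty (comap Complex.im atTop) := by
    simpa using tendsto_im_affine 2 0 0 (by norm_num)
  have h : γ 1 0 % 4 = 0 ∨ γ 1 0 % 4 = 2 ∨ γ 1 0 % 2 = 1 := by omega
  rcases h with h | h | h
  · rw [cuspVal, if_pos h, chiInt_zero_zero_eq h, pow_one]
    simp only [funext (thetaRow_of_zero h (γ 1 1))]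
    simpa using ((tendsto_jacobiTheta.comp h2).pow 2).const_mul (chiInt (γ 1 1))
  · rw [cuspVal, if_neg (by omega), chiInt_of_two h]
    simp only [funext (thetaRow_of_two h (γ 1 1))]
    simpa using ((tendsto_thetaTwo.comp h2).pow 2).const_mul (chiInt (γ 1 1))
  · rw [cuspVal, if_neg (by omega), pow_one]
    simp only [funext (thetaRow_of_odd h (rfl : (γ 1 0 * γ 1 1) % 4 = _))]
    have h3 : Tendsto (fun τ : ℍ => ((τ : ℂ) + (γ 1 0 * γ 1 1 : ℤ)) / 2) atImInfty
        (comap Complex.im atTop) := by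
      convert! tendsto_im_affine (1 / 2) ((γ 1 0 * γ 1 1 : ℤ) / 2) 0 (by norm_num) using 2 with τ
      push_cast; ring
    simpa using ((tendsto_jacobiTheta.comp h3).pow 2).const_mul
      (chiInt (γ 1 0) * (-Complex.I / 2))

theorem differentiableOn_z {a : ℕ} (ha : 0 < a) :
    DifferentiableOn ℂ (z a) {w | 0 < w.im} := by
  intro w hw
  have hw' : 0 < w.im := hw
  have ha' : (0 : ℝ) < a := by exact_mod_cast ha
  rw [show z a = fun τ => jacobiTheta (2 * (a * τ)) ^ 2 from funext fun τ => z_eq_jacobiTheta a τ]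
  have h1 : 0 < (2 * (a * w) : ℂ).im := by
    have : (2 * (a * w) : ℂ).im = 2 * (a * w.im) := by simp
    rw [this]; positivity
  refine DifferentiableAt.differentiableWithinAt (DifferentiableAt.pow ?_ 2)
  exact DifferentiableAt.comp (f := fun w : ℂ => 2 * ((a : ℂ) * w)) w
    (differentiableAt_jacobiTheta h1) (by fun_prop)

/-! ### Power series in the nome -/

theorem norm_nome (τ : ℂ) : ‖nome τ‖ = Real.exp (-(2 * Real.pi) * τ.im) := by
  rw [nome, Complex.norm_exp]
  congr 1
  rw [show (2 * Real.pi * Complex.I * τ : ℂ) = ((2 * Real.pi : ℝ) : ℂ) * (Complex.I * τ) by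
    push_cast; ring, Complex.re_ofReal_mul, Complex.I_mul_re]
  ring

theorem norm_nome_lt_one {τ : ℂ} (h : 0 < τ.im) : ‖nome τ‖ < 1 := by
  rw [norm_nome]
  exact Real.exp_lt_one_iff.mpr (by have := Real.pi_pos; nlinarith)

theorem tendsto_nome : Tendsto nome (comap Complex.im atTop) (𝓝 0) := by
  rw [tendsto_zero_iff_norm_tendsto_zero]
  simp only [norm_nome]
  refine Real.tendsto_exp_atBot.comp ?_
  exact tendsto_comap.const_mul_atTop_of_neg (by have := Real.pi_pos; linarith)

theorem differentiableOn_powerSeries {a : ℕ+ → ℂ} {m : ℕ} (ha : ∀ n, ‖a n‖ ≤ ((n : ℕ) : ℝ) ^ m) :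
    DifferentiableOn ℂ (fun w : ℂ => ∑' n : ℕ+, a n * w ^ (n : ℕ)) (Metric.ball 0 1) := by
  intro w hw
  rw [mem_ball_zero_iff] at hw
  obtain ⟨r, hr0, hr1⟩ := exists_between hw
  have hr : 0 ≤ r := (norm_nonneg w).trans hr0.le
  have hs0 : Summable fun n : ℕ => (n : ℝ) ^ m * r ^ n :=
    summable_pow_mul_geometric_of_norm_lt_one m (by rwa [Real.norm_of_nonneg hr])
  have hs : Summable fun n : ℕ+ => ((n : ℕ) : ℝ) ^ m * r ^ (n : ℕ) :=
    hs0.comp_injective PNat.coe_injective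
  have hd := Complex.differentiableOn_tsum_of_summable_norm (U := Metric.ball (0 : ℂ) r)
    (F := fun (n : ℕ+) (w : ℂ) => a n * w ^ (n : ℕ)) hs
    (fun n => by fun_prop) Metric.isOpen_ball (fun n w hw => by
      rw [mem_ball_zero_iff] at hw
      rw [norm_mul, norm_pow]
      gcongr
      exact ha n)
  exact (hd.differentiableAt (Metric.isOpen_ball.mem_nhds (by
    rwa [mem_ball_zero_iff]))).differentiableWithinAt

theorem differentiableOn_tsum_nome {a : ℕ+ → ℂ} {m : ℕ} (ha : ∀ n, ‖a n‖ ≤ ((n : ℕ) : ℝ) ^ m) :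
    DifferentiableOn ℂ (fun τ : ℂ => ∑' n : ℕ+, a n * nome τ ^ (n : ℕ)) {τ | 0 < τ.im} := by
  refine (differentiableOn_powerSeries ha).comp (f := nome) ?_ fun τ hτ => ?_
  · unfold nome; fun_prop
  · rw [mem_ball_zero_iff]; exact norm_nome_lt_one hτ

theorem tendsto_tsum_nome {a : ℕ+ → ℂ} {m : ℕ} (ha : ∀ n, ‖a n‖ ≤ ((n : ℕ) : ℝ) ^ m) :
    Tendsto (fun τ : ℍ => ∑' n : ℕ+, a n * nome τ ^ (n : ℕ)) atImInfty (𝓝 0) := by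
  have h1 := ((differentiableOn_powerSeries ha).differentiableAt
    (Metric.isOpen_ball.mem_nhds (Metric.mem_ball_self one_pos))).continuousAt
  have h3 := h1.tendsto.comp (tendsto_nome.comp tendsto_coe_atImInfty)
  simpa [Function.comp_def] using h3

theorem norm_divisor_sum_le {w : ℕ → ℂ} (hw : ∀ d, ‖w d‖ ≤ 1) (k n : ℕ) :
    ‖∑ d ∈ n.divisors, w d * (d : ℂ) ^ k‖ ≤ (n : ℝ) ^ (k + 1) := by
  calc ‖∑ d ∈ n.divisors, w d * (d : ℂ) ^ k‖ ≤ ∑ d ∈ n.divisors, (d : ℝ) ^ k := by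
        refine norm_sum_le_of_le _ fun d _ => ?_
        rw [norm_mul, norm_pow, Complex.norm_natCast]
        exact mul_le_of_le_one_left (by positivity) (hw d)
    _ = ((ArithmeticFunction.sigma k n : ℕ) : ℝ) := by
        rw [ArithmeticFunction.sigma_apply]; push_cast; rfl
    _ ≤ (n : ℝ) ^ (k + 1) := by exact_mod_cast ArithmeticFunction.sigma_le_pow_succ k n

/-! ### Eisenstein series of even weight -/

theorem norm_sigma_le (k : ℕ) (n : ℕ+) :
    ‖∑ d ∈ (n : ℕ).divisors, (d : ℂ) ^ (k - 1)‖ ≤ ((n : ℕ) : ℝ) ^ (k - 1 + 1) := by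
  simpa using norm_divisor_sum_le (w := fun _ => 1) (by simp) (k - 1) n

theorem differentiableOn_eisE (k : ℕ) : DifferentiableOn ℂ (eisE k) {τ | 0 < τ.im} :=
  ((differentiableOn_tsum_nome (norm_sigma_le k)).const_mul _).const_sub _

theorem tendsto_eisE (k : ℕ) : Tendsto (fun τ : ℍ => eisE k τ) atImInfty (𝓝 1) := by
  simpa [eisE] using ((tendsto_tsum_nome (norm_sigma_le k)).const_mul
    (2 * (k : ℂ) / ((bernoulli k : ℚ) : ℂ))).const_sub 1

theorem eisE_eq_E {k : ℕ} (hk : 3 ≤ k) (hk2 : Even k) (τ : ℍ) :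
    eisE k τ = ModularForm.E hk τ := by
  rw [EisensteinSeries.q_expansion_bernoulli hk hk2, eisE]
  simp [nome, ArithmeticFunction.sigma_apply]

theorem eisE_two_eq_E2 (τ : ℍ) : eisE 2 τ = EisensteinSeries.E2 τ := by
  rw [EisensteinSeries.E2_eq_tsum_cexp, eisE, bernoulli_two]
  simp [nome, ArithmeticFunction.sigma_apply]
  norm_num

theorem eisE_two_slash (γ : SL(2, ℤ)) (τ : ℍ) :
    ((fun τ : ℍ => eisE 2 τ) ∣[(2 : ℤ)] γ) τ =
      eisE 2 τ - 6 * Complex.I / Real.pi * (γ 1 0 / denom γ τ) := by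
  rw [show (fun τ : ℍ => eisE 2 τ) = EisensteinSeries.E2 from funext eisE_two_eq_E2,
    EisensteinSeries.E2_slash_action, eisE_two_eq_E2]
  have hpi : (Real.pi : ℂ) ≠ 0 := by exact_mod_cast Real.pi_ne_zero
  simp only [Pi.sub_apply, Pi.smul_apply, EisensteinSeries.D2, riemannZeta_two, smul_eq_mul]
  field_simp

/-- The completion of the Eisenstein series of even weight `k` that is invariant under
`SL(2, ℤ)`: it differs from `E_k` only for `k = 2`, by the nonholomorphic term `3 / (π Im τ)`. -/
noncomputable def eisEStar (k : ℕ) (τ : ℍ) : ℂ :=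
  eisE k τ - if k = 2 then (3 / (Real.pi * τ.im) : ℂ) else 0

theorem eisEStar_slash {k : ℕ} (hk : 1 < k) (hk2 : Even k) (γ : SL(2, ℤ)) :
    eisEStar k ∣[(k : ℤ)] γ = eisEStar k := by
  by_cases h : k = 2
  · subst h
    ext τ
    have hE := eisE_two_slash γ τ
    rw [ModularForm.SL_slash_apply] at hE ⊢
    have hd := denom_ne_zero γ τ
    have hpi : (Real.pi : ℂ) ≠ 0 := by exact_mod_cast Real.pi_ne_zero
    have hτ : (τ.im : ℂ) ≠ 0 := by exact_mod_cast τ.im_ne_zero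
    -- `|D|² = D · conj D` and `conj D = D - 2ic Im τ` for `D = cτ + d`.
    have hns : (Complex.normSq (denom γ τ) : ℂ) =
        denom γ τ * (denom γ τ - 2 * Complex.I * γ 1 0 * τ.im) := by
      rw [← Complex.mul_conj, denom_eq]
      congr 1
      simp only [map_add, map_mul, map_intCast]
      have := Complex.sub_conj τ
      simp only [coe_im] at this
      push_cast at this
      linear_combination (-γ 1 0 : ℂ) * this
    have hd2 : denom γ τ - 2 * Complex.I * γ 1 0 * τ.im ≠ 0 := by
      intro h0
      rw [h0, mul_zero] at hns
      exact normSq_denom_ne_zero (γ : GL (Fin 2) ℝ) τ.im_ne_zero (by exact_mod_cast hns)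
    rw [eisEStar, eisEStar, sub_mul, if_pos rfl, if_pos rfl]
    push_cast at hE ⊢
    rw [hE, ModularGroup.im_smul_eq_div_normSq]
    push_cast
    rw [hns]
    generalize denom γ τ = D at *
    rw [zpow_neg]
    have e : (3 / (Real.pi * (τ.im / (D * (D - 2 * Complex.I * γ 1 0 * τ.im)))) *
      (D ^ (2 : ℤ))⁻¹ : ℂ) = 3 / (Real.pi * τ.im) - 6 * Complex.I / Real.pi * (γ 1 0 / D) := by
      rw [show (D ^ (2 : ℤ)) = D ^ 2 by norm_cast]
      field_simp
      ring
    rw [e]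
    ring
  · have hk3 : 3 ≤ k := by omega
    have : eisEStar k = ModularForm.E hk3 := by
      ext τ; rw [eisEStar, if_neg h, sub_zero, eisE_eq_E hk3 hk2]
    rw [this]
    exact SlashInvariantFormClass.slash_action_eq (ModularForm.E hk3) _ ⟨γ, rfl⟩

theorem tendsto_eisEStar (k : ℕ) : Tendsto (eisEStar k) atImInfty (𝓝 1) := by
  have h2 : Tendsto (fun τ : ℍ => if k = 2 then (3 / (Real.pi * τ.im) : ℂ) else 0) atImInfty
      (𝓝 0) := by
    split_ifs
    · have : Tendsto (fun τ : ℍ => 3 / (Real.pi * τ.im)) atImInfty (𝓝 0) :=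
        (tendsto_comap.const_mul_atTop Real.pi_pos).const_div_atTop 3
      have h3 := (Complex.continuous_ofReal.tendsto 0).comp this
      simpa [Function.comp_def] using h3
    · exact tendsto_const_nhds
  have h3 := (tendsto_eisE k).sub h2
  rw [sub_zero] at h3
  exact h3

/-! ### Forms of level four with prescribed values at the cusps -/

/-- `f` transforms in weight `k` under `Γ₀(4)` with character `χ_{-4}^k`, has the value `L∞` at the
cusp `∞` and the value `L₀` at the cusp `0`, and vanishes at the cusp `1/2`. Holomorphy is not
included, so that the completed Eisenstein series of weight two is admitted. -/
structure LevelFour (k : ℕ) (Linf L0 : ℂ) (f : ℍ → ℂ) : Prop where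
  slash : ∀ γ : SL(2, ℤ), γ 1 0 % 4 = 0 → f ∣[(k : ℤ)] γ = chiInt (γ 1 1) ^ k • f
  tendsto : ∀ γ : SL(2, ℤ), Tendsto (f ∣[(k : ℤ)] γ) atImInfty (𝓝 (cuspVal k Linf L0 γ))

theorem levelFour_z : LevelFour 1 1 (-Complex.I / 2) (fun τ : ℍ => z 1 τ) where
  slash γ h := by
    rw [Nat.cast_one, z_one_slash]
    ext τ
    rw [thetaRow_of_zero h, Pi.smul_apply, z_eq_jacobiTheta]
    simp
  tendsto γ := tendsto_z_one_slash γ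

/-- Dilating by `p` raises the level by the factor `p`. -/
theorem LevelFour.slash_dilate {k : ℕ} {Linf L0 : ℂ} {f : ℍ → ℂ} (hf : LevelFour k Linf L0 f)
    {p : ℕ+} {γ : SL(2, ℤ)} (hγ : ((4 * (p : ℕ) : ℕ) : ℤ) ∣ γ 1 0) :
    (fun τ => f (dilate p τ)) ∣[(k : ℤ)] γ = chiInt (γ 1 1) ^ k • fun τ => f (dilate p τ) := by
  obtain ⟨c, hc⟩ := hγ
  have hdet := det_eq_one γ
  rw [hc] at hdet
  push_cast at hdet hc
  -- The conjugate of `γ` by `diag(p, 1)`.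
  let γ₁ : SL(2, ℤ) := ⟨!![γ 0 0, (p : ℕ) * γ 0 1; 4 * c, γ 1 1], by
    rw [Matrix.det_fin_two_of]; linear_combination hdet⟩
  ext τ
  have h := RamanujanMordell.slash_dilate (k : ℤ) f (a := p) (α := p) (δ := 1) (β := 0) (γ := γ)
    (γ₁ := γ₁) (by simp [γ₁]; ring) (by simp [γ₁]) (by simp [γ₁, hc]; ring) (by simp [γ₁]) τ
  rw [h, hf.slash γ₁ (by simp [γ₁])]
  simp [γ₁, dilate]

/-- The values of `f(pτ)` at the cusps. -/
theorem LevelFour.tendsto_dilate_prime {k : ℕ} {Linf L0 : ℂ} {f : ℍ → ℂ}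
    (hf : LevelFour k Linf L0 f) {p : ℕ+} (hp : (p : ℕ).Prime) (hp2 : (p : ℕ) ≠ 2)
    (γ : SL(2, ℤ)) :
    Tendsto ((fun τ => f (dilate p τ)) ∣[(k : ℤ)] γ) atImInfty
      (𝓝 (if ((p : ℕ) : ℤ) ∣ γ 1 0 then cuspVal k Linf (chiInt (p : ℕ) ^ k * L0) γ
        else cuspVal k ((chiInt (p : ℕ) / (p : ℕ)) ^ k * Linf) (L0 / (p : ℕ) ^ k) γ)) := by
  obtain ⟨α, δ, β, γ₁, hα, hαδ, h00, h10, hsl⟩ := exists_slash_dilate p γ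
  have h := tendsto_slash_dilate (hsl k f) (hf.tendsto γ₁)
  have hpodd : ((p : ℕ) : ℤ) % 2 = 1 := by
    have := hp.eq_two_or_odd; omega
  have hgcd : ((p : ℕ) : ℤ) ∣ γ 1 0 ∧ α = p ∧ δ = 1 ∨ ¬((p : ℕ) : ℤ) ∣ γ 1 0 ∧ α = 1 ∧ δ = p := by
    by_cases hd : ((p : ℕ) : ℤ) ∣ γ 1 0
    · have h1 : α = p := PNat.eq (by
        rw [hα, Int.gcd_eq_left (by positivity) hd |> Nat.cast_injective])
      refine Or.inl ⟨hd, h1, ?_⟩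
      rw [h1] at hαδ
      exact mul_left_cancel (hαδ.trans (mul_one p).symm)
    · have h1 : α = 1 := PNat.eq (by
        rw [hα]
        exact (Nat.Prime.coprime_iff_not_dvd hp).mpr (by rwa [← Int.natCast_dvd]))
      refine Or.inr ⟨hd, h1, ?_⟩
      rwa [h1, one_mul] at hαδ
  have hp4 : IsCoprime ((4 : ℤ)) ((p : ℕ) : ℤ) := by
    have : IsCoprime (2 : ℤ) ((p : ℕ) : ℤ) :=
      ⟨-(((p : ℕ) : ℤ) / 2), 1, by omega⟩
    simpa using this.pow_left (m := 2)
  have hχ2 := chiInt_sq hpodd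
  convert h using 2
  rcases hgcd with ⟨hd, rfl, rfl⟩ | ⟨hd, rfl, rfl⟩
  · rw [if_pos hd, cuspVal, cuspVal, h00, h10]
    have : γ₁ 1 0 * ((α : ℕ) : ℤ) % 4 = 0 ↔ γ₁ 1 0 % 4 = 0 := by
      rw [← Int.dvd_iff_emod_eq_zero, ← Int.dvd_iff_emod_eq_zero]
      exact ⟨hp4.dvd_of_dvd_mul_right, fun h => h.mul_right _⟩
    simp only [this, PNat.one_coe, Nat.cast_one, one_mul, one_zpow, inv_one, chiInt_mul,
      mul_pow]
    have hχk : chiInt ((α : ℕ) : ℤ) ^ k * chiInt ((α : ℕ) : ℤ) ^ k = 1 := by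
      rw [← mul_pow, ← sq, hχ2, one_pow]
    congr 1
    linear_combination chiInt (γ₁ 1 0) ^ k * L0 * hχk
  · rw [if_neg hd, cuspVal, cuspVal, h00, h10]
    simp only [PNat.one_coe, Nat.cast_one, mul_one, chiInt_mul, mul_pow, div_pow, zpow_natCast]
    split_ifs <;> ring

/-! ### Eisenstein series of level four and even weight -/

/-- If `f` has level one, then `f(aτ)` is invariant under `Γ₀(a)`. -/
theorem slash_dilate_of_dvd {k : ℤ} {f : ℍ → ℂ} (hf : ∀ γ : SL(2, ℤ), f ∣[k] γ = f) {a : ℕ+}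
    {γ : SL(2, ℤ)} (hγ : ((a : ℕ) : ℤ) ∣ γ 1 0) :
    (fun τ => f (dilate a τ)) ∣[k] γ = fun τ => f (dilate a τ) := by
  obtain ⟨c, hc⟩ := hγ
  have hdet := det_eq_one γ
  rw [hc] at hdet
  let γ₁ : SL(2, ℤ) := ⟨!![γ 0 0, (a : ℕ) * γ 0 1; c, γ 1 1], by
    rw [Matrix.det_fin_two_of]; linear_combination hdet⟩
  ext τ
  have h := slash_dilate k f (a := a) (α := a) (δ := 1) (β := 0) (γ := γ) (γ₁ := γ₁)
    (by simp [γ₁]; ring) (by simp [γ₁]) (by simp [γ₁, hc]; ring) (by simp [γ₁]) τ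
  rw [h, hf γ₁]
  simp [dilate]

/-- The value of `f(aτ)` at the cusp `γ ∞`, for `f` of level one with the value `1` at `∞`. -/
theorem tendsto_slash_dilate_levelOne {k : ℕ} {f : ℍ → ℂ} (hf : ∀ γ : SL(2, ℤ), f ∣[(k : ℤ)] γ = f)
    (h1 : Tendsto f atImInfty (𝓝 1)) {a δ : ℕ+} {γ : SL(2, ℤ)}
    (hδ : Int.gcd (a : ℕ) (γ 1 0) * (δ : ℕ) = a) :
    Tendsto ((fun τ => f (dilate a τ)) ∣[(k : ℤ)] γ) atImInfty (𝓝 ((((δ : ℕ) : ℂ) ^ k)⁻¹)) := by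
  obtain ⟨α, δ', β, γ₁, hα, hαδ, h00, h10, hsl⟩ := exists_slash_dilate a γ
  have h := tendsto_slash_dilate (hsl k f) (by rwa [hf γ₁])
  have : δ' = δ := by
    apply mul_left_cancel (a := α)
    apply PNat.eq
    rw [hαδ, PNat.mul_coe, hα, hδ]
  rw [this] at h
  simpa using h

/-- The Eisenstein series of even weight and level four with the value `1` at `∞`, the value
`ε (-i/2)^k` at `0` and the value `0` at `1/2`; here `ε = ± 1`. -/
noncomputable def evenEis (k : ℕ) (ε : ℂ) (τ : ℍ) : ℂ :=
  ε / (2 ^ k - 1) * ((-1) ^ (k / 2) * eisEStar k (dilate 1 τ)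
    - ((-1) ^ (k / 2) + ε) * eisEStar k (dilate 2 τ) + ε * 2 ^ k * eisEStar k (dilate 4 τ))

theorem two_pow_sub_one_ne_zero {k : ℕ} (hk : 1 < k) : (2 : ℂ) ^ k - 1 ≠ 0 := by
  have : (1 : ℕ) < 2 ^ k := Nat.one_lt_two_pow (by omega)
  rw [sub_ne_zero]
  exact_mod_cast this.ne'

theorem neg_I_div_two_pow {k : ℕ} (hk2 : Even k) :
    (-Complex.I / 2) ^ k = (-1) ^ (k / 2) * ((2 : ℂ) ^ k)⁻¹ := by
  obtain ⟨m, rfl⟩ := hk2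
  rw [show (m + m) / 2 = m by omega, ← two_mul, div_pow, pow_mul, neg_sq, Complex.I_sq,
    div_eq_mul_inv]

theorem levelFour_evenEis {k : ℕ} (hk : 1 < k) (hk2 : Even k) {ε : ℂ} (hε : ε ^ 2 = 1) :
    LevelFour k 1 (ε * (-Complex.I / 2) ^ k) (evenEis k ε) := by
  have hinv := eisEStar_slash hk hk2
  have h2k := two_pow_sub_one_ne_zero hk
  have h2k' : (2 : ℂ) ^ k ≠ 0 := pow_ne_zero _ two_ne_zero
  set f : ℕ+ → ℍ → ℂ := fun a τ => eisEStar k (dilate a τ) with hf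
  have hdef : evenEis k ε = (ε / (2 ^ k - 1)) • ((-1 : ℂ) ^ (k / 2) • f 1
      - ((-1) ^ (k / 2) + ε) • f 2 + (ε * 2 ^ k) • f 4) := by
    ext τ; simp [evenEis, hf]
  have hsl : ∀ γ : SL(2, ℤ), evenEis k ε ∣[(k : ℤ)] γ =
      (ε / (2 ^ k - 1)) • ((-1 : ℂ) ^ (k / 2) • (f 1 ∣[(k : ℤ)] γ)
      - ((-1) ^ (k / 2) + ε) • (f 2 ∣[(k : ℤ)] γ) + (ε * 2 ^ k) • (f 4 ∣[(k : ℤ)] γ)) := by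
    intro γ
    rw [hdef]
    simp only [sub_eq_add_neg, SlashAction.neg_slash, ModularForm.SL_smul_slash,
      SlashAction.add_slash]
  constructor
  · intro γ hγ
    have h4 : (4 : ℤ) ∣ γ 1 0 := Int.dvd_of_emod_eq_zero hγ
    have h1 : chiInt (γ 1 1) ^ k = 1 := by
      obtain ⟨m, rfl⟩ := hk2
      rw [← two_mul, pow_mul, ← chiInt_zero_zero_eq hγ, chiInt_sq (zero_zero_odd (by omega)),
        one_pow]
    rw [hsl, h1, one_smul, hdef, hf]
    simp only
    rw [slash_dilate_of_dvd hinv (a := 1) (by simp), slash_dilate_of_dvd hinv (a := 2) (by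
        exact (by norm_num : (2 : ℤ) ∣ 4).trans h4), slash_dilate_of_dvd hinv (a := 4) h4]
  · intro γ
    rw [hsl]
    -- With `c = γ 1 0`, `d1 = 2 / gcd(2, c)` and `d2 = 4 / gcd(4, c)` determine the values of
    -- `E_k(2τ)` and `E_k(4τ)` at the cusp `γ ∞`.
    obtain ⟨d1, d2, hd, hval⟩ : ∃ d1 d2 : ℕ+, (Int.gcd ((2 : ℕ+) : ℕ) (γ 1 0) * (d1 : ℕ) = 2 ∧
        Int.gcd ((4 : ℕ+) : ℕ) (γ 1 0) * (d2 : ℕ) = 4) ∧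
        cuspVal k 1 (ε * (-Complex.I / 2) ^ k) γ = (ε / (2 ^ k - 1)) * ((-1 : ℂ) ^ (k / 2) * 1
          - ((-1) ^ (k / 2) + ε) * (((d1 : ℕ) : ℂ) ^ k)⁻¹ +
          (ε * 2 ^ k) * (((d2 : ℕ) : ℂ) ^ k)⁻¹) := by
      have hg : ∀ n : ℕ, Int.gcd (n : ℤ) (γ 1 0) = Nat.gcd n (γ 1 0).natAbs := fun n => rfl
      have h : γ 1 0 % 4 = 0 ∨ γ 1 0 % 4 = 2 ∨ γ 1 0 % 2 = 1 := by omega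
      have hev : ∀ {n : ℤ}, n % 2 = 1 → chiInt n ^ k = 1 := fun {n} hn => by
        obtain ⟨m, rfl⟩ := hk2
        rw [← two_mul, pow_mul, chiInt_sq hn, one_pow]
      have e4 : (4 : ℂ) ^ k = 2 ^ k * 2 ^ k := by rw [← mul_pow]; norm_num
      rcases h with h | h | h
      · refine ⟨1, 1, ⟨?_, ?_⟩, ?_⟩
        · rw [hg, Nat.gcd_eq_left (by show 2 ∣ _; omega)]; rfl
        · rw [hg, Nat.gcd_eq_left (by show 4 ∣ _; omega)]; rfl
        · rw [cuspVal, if_pos h, hev (zero_zero_odd (by omega))]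
          simp only [PNat.one_coe, Nat.cast_one, one_pow, inv_one]
          field_simp
          linear_combination (1 - 2 ^ k) * hε
      · refine ⟨1, 2, ⟨?_, ?_⟩, ?_⟩
        · rw [hg, Nat.gcd_eq_left (by show 2 ∣ _; omega)]; rfl
        · rw [hg]
          have : Nat.gcd 4 (γ 1 0).natAbs = 2 := by
            rw [Nat.gcd_rec, show (γ 1 0).natAbs % 4 = 2 by omega]; rfl
          exact (congrArg (· * 2) this)
        · rw [cuspVal, if_neg (by omega), chiInt_of_two h, zero_pow (by omega)]
          simp only [Nat.cast_one, one_pow, inv_one, PNat.val_ofNat, Nat.cast_ofNat]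
          field_simp
          ring
      · refine ⟨2, 4, ⟨?_, ?_⟩, ?_⟩
        · rw [hg]
          have : Nat.gcd 2 (γ 1 0).natAbs = 1 := by
            rw [Nat.gcd_rec, show (γ 1 0).natAbs % 2 = 1 by omega]; rfl
          exact (congrArg (· * 2) this)
        · rw [hg]
          have : Nat.gcd 4 (γ 1 0).natAbs = 1 := by
            rw [show (4 : ℕ) = 2 ^ 2 by norm_num]
            apply Nat.Coprime.pow_left
            rw [Nat.coprime_two_left, Nat.odd_iff]; omega
          exact (congrArg (· * 4) this)
        · rw [cuspVal, if_neg (by omega), hev h, neg_I_div_two_pow hk2]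
          simp only [PNat.val_ofNat, Nat.cast_ofNat, e4]
          field_simp
          ring
    rw [hval]
    refine Tendsto.const_mul _ (((Tendsto.const_mul _ ?_).sub (Tendsto.const_mul _ ?_)).add
      (Tendsto.const_mul _ ?_))
    · simpa using tendsto_slash_dilate_levelOne hinv (tendsto_eisEStar k) (a := 1) (δ := 1)
        (γ := γ) (by simp)
    · exact tendsto_slash_dilate_levelOne hinv (tendsto_eisEStar k) hd.1
    · exact tendsto_slash_dilate_levelOne hinv (tendsto_eisEStar k) hd.2

/-! ### The Eisenstein part in even weight -/

theorem dilate_im (a : ℕ+) (τ : ℍ) : (dilate a τ).im = ((a : ℕ) : ℝ) * τ.im := by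
  rw [dilate, affine_im]; simp

/-- For even `k` the function `F_p(k, j; aτ)` is a level four Eisenstein series at `aτ`, up to the
nonholomorphic term of the completion in weight two. -/
theorem F_even {p k j : ℕ} (hk2 : Even k) (hε : ((chi p : ℂ) ^ j) ^ 2 = 1)
    (a : ℕ+) (τ : ℍ) :
    F p k j a τ = evenEis k ((chi p : ℂ) ^ j) (dilate a τ) +
      if k = 2 then (1 - (chi p : ℂ) ^ j) / (2 * Real.pi * (a : ℕ) * τ.im) else 0 := by
  have key : ∀ σ : ℍ, eisE k σ = eisEStar k σ + if k = 2 then (3 / (Real.pi * σ.im) : ℂ) else 0 :=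
    fun σ => by rw [eisEStar, sub_add_cancel]
  have h1 : ((a : ℕ) : ℂ) * τ = dilate 1 (dilate a τ) := by simp [coe_dilate]
  have h2 : 2 * (((a : ℕ) : ℂ) * τ) = dilate 2 (dilate a τ) := by simp [coe_dilate]
  have h4 : 4 * (((a : ℕ) : ℂ) * τ) = dilate 4 (dilate a τ) := by simp [coe_dilate]
  rw [F, if_pos hk2, h1, key, ← h1, h2, key, h4, key, evenEis]
  generalize (chi p : ℂ) ^ j = ε at *
  by_cases h : k = 2
  · subst h
    have hpi : (Real.pi : ℂ) ≠ 0 := by exact_mod_cast Real.pi_ne_zero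
    have hτ : (τ.im : ℂ) ≠ 0 := by exact_mod_cast τ.im_ne_zero
    have ha : ((a : ℕ) : ℂ) ≠ 0 := by exact_mod_cast a.pos.ne'
    simp only [if_true, dilate_im]
    push_cast
    norm_num
    field_simp
    linear_combination (3 : ℂ) * hε
  · simp only [if_neg h]
    ring

theorem chi_sq {p : ℕ} (hp : p.Prime) (hp2 : p ≠ 2) : (chi p : ℂ) ^ 2 = 1 := by
  rw [chi_eq_chiInt]
  have := hp.eq_two_or_odd
  exact chiInt_sq (by omega)

theorem chi_eq_or {p : ℕ} (hp : p.Prime) (hp2 : p ≠ 2) : (chi p : ℂ) = 1 ∨ (chi p : ℂ) = -1 :=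
  mul_self_eq_one_iff.mp (by rw [← sq, chi_sq hp hp2])

theorem pChi_pow_sub_one_ne_zero {p k : ℕ} (hp : p.Prime) (hp2 : p ≠ 2) (hk : 1 < k) :
    pChi p ^ k - 1 ≠ 0 := by
  intro h
  have h1 : ‖pChi p ^ k‖ = 1 := by rw [sub_eq_zero.mp h, norm_one]
  have h2 : ‖(chi p : ℂ)‖ = 1 := by
    rcases chi_eq_or hp hp2 with h | h <;> simp [h]
  rw [pChi, norm_pow, norm_mul, h2, one_mul, Complex.norm_natCast] at h1
  have h3 : 1 < p ^ k := Nat.one_lt_pow (by omega) hp.one_lt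
  have h4 : p ^ k = 1 := by exact_mod_cast h1
  omega

/-- The coefficient of `F_p(k, j; τ)`. -/
noncomputable def coeffOne (p k j : ℕ) : ℂ := (pChi p ^ (k - j) - 1) / (pChi p ^ k - 1)

/-- The coefficient of `F_p(k, j; pτ)`. -/
noncomputable def coeffP (p k j : ℕ) : ℂ := (pChi p ^ k - pChi p ^ (k - j)) / (pChi p ^ k - 1)

/-- The nonholomorphic terms in weight two cancel between `F_p(2, j; τ)` and `F_p(2, j; pτ)`. -/
theorem coeff_weight_two {p j : ℕ} (hp : p.Prime) (hp2 : p ≠ 2) (hj : j ≤ 2) :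
    (coeffOne p 2 j + coeffP p 2 j / p) * (1 - (chi p : ℂ) ^ j) = 0 := by
  have h0 := pChi_pow_sub_one_ne_zero hp hp2 (by norm_num : 1 < 2)
  have hp0 : (p : ℂ) ≠ 0 := by exact_mod_cast hp.pos.ne'
  rcases chi_eq_or hp hp2 with h | h
  · simp [h]
  · interval_cases j
    · simp
    · have hP : pChi p = -p := by rw [pChi, h]; ring
      rw [coeffOne, coeffP, hP] at *
      field_simp
      simp
      left; left; ring
    · simp [h]

/-- For even `k` the Eisenstein part of the formula is a combination of forms of level four. -/
theorem eisenstein_part_even {p k j : ℕ} (hp : p.Prime) (hp2 : p ≠ 2) (hk : 1 < k) (hj : j ≤ k)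
    (hk2 : Even k) :
    ∃ K₁ K₂ : ℍ → ℂ, LevelFour k 1 ((chi p : ℂ) ^ j * (-Complex.I / 2) ^ k) K₁ ∧
      LevelFour k 1 ((chi p : ℂ) ^ (j + k) * (-Complex.I / 2) ^ k) K₂ ∧
      ∀ τ : ℍ, coeffOne p k j * F p k j 1 τ + coeffP p k j * F p k j p τ =
        coeffOne p k j * K₁ τ + coeffP p k j * K₂ (dilate ⟨p, hp.pos⟩ τ) := by
  have hε : ((chi p : ℂ) ^ j) ^ 2 = 1 := by
    rw [← pow_mul, mul_comm, pow_mul, chi_sq hp hp2, one_pow]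
  have hχk : (chi p : ℂ) ^ k = 1 := by
    obtain ⟨m, rfl⟩ := hk2
    rw [← two_mul, pow_mul, chi_sq hp hp2, one_pow]
  refine ⟨_, _, levelFour_evenEis hk hk2 hε, by
    rw [pow_add, hχk, mul_one]; exact levelFour_evenEis hk hk2 hε, fun τ => ?_⟩
  have h1 := F_even hk2 hε 1 τ
  have hP := F_even hk2 hε ⟨p, hp.pos⟩ τ
  have hd : dilate 1 τ = τ := by ext1; simp [coe_dilate]
  rw [PNat.one_coe, hd] at h1
  rw [PNat.mk_coe] at hP
  rw [h1, hP]
  by_cases h : k = 2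
  · subst h
    have hc := coeff_weight_two hp hp2 hj
    have hp0 : (p : ℂ) ≠ 0 := by exact_mod_cast hp.pos.ne'
    have hpi : (Real.pi : ℂ) ≠ 0 := by exact_mod_cast Real.pi_ne_zero
    have hτ : (τ.im : ℂ) ≠ 0 := by exact_mod_cast τ.im_ne_zero
    simp only [if_true, Nat.cast_one, mul_one]
    rw [show ∀ a b c d : ℂ, a * (b + (1 - (chi p : ℂ) ^ j) / (2 * Real.pi * τ.im)) +
      c * (d + (1 - (chi p : ℂ) ^ j) / (2 * Real.pi * p * τ.im)) =
      a * b + c * d + (a + c / p) * (1 - (chi p : ℂ) ^ j) / (2 * Real.pi * τ.im) by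
        intros; field_simp; ring, hc]
    simp
  · simp [h]

/-! ### Lattice sums with bounded weights -/

/-- The Eisenstein series `∑ w(c, d) (cτ + d)^{-k}` over all integers `c`, `d`. -/
noncomputable def latticeSum (w : ℤ → ℤ → ℂ) (k : ℕ) (τ : ℍ) : ℂ :=
  ∑' v : Fin 2 → ℤ, w (v 0) (v 1) * EisensteinSeries.eisSummand k v τ

theorem summable_latticeSum {w : ℤ → ℤ → ℂ} (hw : ∀ c d, ‖w c d‖ ≤ 1) {k : ℕ} (hk : 3 ≤ k)
    (τ : ℍ) : Summable fun v : Fin 2 → ℤ =>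
      w (v 0) (v 1) * EisensteinSeries.eisSummand k v τ := by
  refine Summable.of_norm_bounded
    (EisensteinSeries.summable_norm_eisSummand (k := k) (by exact_mod_cast hk) τ) fun v => ?_
  rw [norm_mul]
  exact mul_le_of_le_one_left (norm_nonneg _) (hw _ _)

/-- The group `SL(2, ℤ)` acts on the weights of a lattice sum through `(c, d) ↦ (c, d) γ⁻¹`. -/
theorem latticeSum_slash (w : ℤ → ℤ → ℂ) (k : ℕ) (γ : SL(2, ℤ)) :
    latticeSum w k ∣[(k : ℤ)] γ =
      latticeSum (fun c d => w (c * γ 1 1 - d * γ 1 0) (-(c * γ 0 1) + d * γ 0 0)) k := by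
  ext τ
  have hdet := det_eq_one γ
  let e : (Fin 2 → ℤ) ≃ (Fin 2 → ℤ) :=
    { toFun := fun v => ![v 0 * γ 0 0 + v 1 * γ 1 0, v 0 * γ 0 1 + v 1 * γ 1 1]
      invFun := fun v => ![v 0 * γ 1 1 - v 1 * γ 1 0, -(v 0 * γ 0 1) + v 1 * γ 0 0]
      left_inv := fun v => by
        ext i; fin_cases i
        · simp; linear_combination v 0 * hdet
        · simp; linear_combination v 1 * hdet
      right_inv := fun v => by
        ext i; fin_cases i
        · simp; linear_combination v 0 * hdet
        · simp; linear_combination v 1 * hdet }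
  have hvec : ∀ v : Fin 2 → ℤ, Matrix.vecMul v γ.1 = e v := fun v => by
    ext i; fin_cases i <;> simp [e, Matrix.vecMul, dotProduct, Fin.sum_univ_two]
  rw [ModularForm.SL_slash_apply, latticeSum, latticeSum, ← tsum_mul_right]
  conv_rhs => rw [← e.tsum_eq]
  refine tsum_congr fun v => ?_
  have hd := denom_ne_zero γ τ
  have h0 : e v 0 * γ 1 1 - e v 1 * γ 1 0 = v 0 := by
    simp [e]; linear_combination v 0 * hdet
  have h1 : -(e v 0 * γ 0 1) + e v 1 * γ 0 0 = v 1 := by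
    simp [e]; linear_combination v 1 * hdet
  rw [EisensteinSeries.eisSummand_SL2_apply, hvec, h0, h1]
  calc w (v 0) (v 1) * (denom γ τ ^ (k : ℤ) * EisensteinSeries.eisSummand k (e v) τ) *
        denom γ τ ^ (-(k : ℤ)) = w (v 0) (v 1) * EisensteinSeries.eisSummand k (e v) τ *
        (denom γ τ ^ (k : ℤ) * denom γ τ ^ (-(k : ℤ))) := by ring
    _ = _ := by rw [← zpow_add₀ hd, add_neg_cancel, zpow_zero, mul_one]

theorem latticeSum_T_zpow_smul {w : ℤ → ℤ → ℂ} (hper : ∀ c d n : ℤ, w c (d - 4 * n) = w c d)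
    (k : ℕ) (n : ℤ) (τ : ℍ) :
    latticeSum w k (ModularGroup.T ^ (4 * n) • τ) = latticeSum w k τ := by
  have h := congr_fun (latticeSum_slash w k (ModularGroup.T ^ (4 * n))) τ
  rw [ModularForm.SL_slash_apply, denom_eq] at h
  simp only [ModularGroup.coe_T_zpow] at h
  simp [-ModularGroup.sl_moeb] at h
  rw [h]
  congr 1
  ext c d
  rw [← hper c d (n * c)]
  congr 1
  ring

/-- The constant term of an Eisenstein series is the sum over the terms with `c = 0`. -/
theorem tendsto_latticeSum {w : ℤ → ℤ → ℂ} (hw : ∀ c d, ‖w c d‖ ≤ 1)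
    (hper : ∀ c d n : ℤ, w c (d - 4 * n) = w c d) {k : ℕ} (hk : 3 ≤ k) :
    Tendsto (latticeSum w k) atImInfty (𝓝 (∑' d : ℤ, w 0 d * (d : ℂ) ^ (-(k : ℤ)))) := by
  let g : (Fin 2 → ℤ) → ℂ := fun v => if v 0 = 0 then w 0 (v 1) * (v 1 : ℂ) ^ (-(k : ℤ)) else 0
  have hg : ∑' v, g v = ∑' d : ℤ, w 0 d * (d : ℂ) ^ (-(k : ℤ)) := by
    have hinj : Function.Injective fun d : ℤ => (![0, d] : Fin 2 → ℤ) := fun a b h => by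
      simpa using congr_fun h 1
    rw [← hinj.tsum_eq (f := g)]
    · simp [g]
    · intro v hv
      have h0 : v 0 = 0 := by
        by_contra h0
        exact hv (by simp [g, h0])
      exact ⟨v 1, by ext i; fin_cases i <;> simp [h0]⟩
  rw [← hg]
  have hk' : (2 : ℝ) < k := by exact_mod_cast hk
  -- In a vertical strip the series is dominated; periodicity extends the limit to all of `ℍ`.
  have hstrip : Tendsto (latticeSum w k) (atImInfty ⊓ 𝓟 (verticalStrip 4 1)) (𝓝 (∑' v, g v)) := by
    refine tendsto_tsum_of_dominated_convergence
      (bound := fun v => EisensteinSeries.r ⟨⟨4, 1⟩, one_pos⟩ ^ (-(k : ℝ)) * ‖v‖ ^ (-(k : ℝ)))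
      ((EisensteinSeries.summable_one_div_norm_rpow hk').mul_left _) (fun v => ?_) ?_
    · by_cases h0 : v 0 = 0
      · refine Tendsto.congr' (Eventually.of_forall fun τ => ?_) tendsto_const_nhds
        simp [g, h0, EisensteinSeries.eisSummand]
      · simp only [g, h0, if_false]
        have h1 : Tendsto (fun τ : ℍ => ‖EisensteinSeries.eisSummand k v τ‖) atImInfty (𝓝 0) := by
          have h2 : Tendsto (fun τ : ℍ => τ.im ^ (-(k : ℤ))) atImInfty (𝓝 0) :=
            (tendsto_zpow_atTop_zero (by omega)).comp tendsto_comap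
          refine squeeze_zero (fun _ => norm_nonneg _) (fun τ => ?_) h2
          rw [EisensteinSeries.eisSummand, norm_zpow, zpow_neg, zpow_neg, zpow_natCast,
            zpow_natCast]
          have h3 : (1 : ℝ) ≤ |(v 0 : ℝ)| := by
            exact_mod_cast Int.one_le_abs h0
          have h4 : τ.im ≤ ‖(v 0 : ℂ) * τ + v 1‖ := by
            refine le_trans ?_ (Complex.abs_im_le_norm _)
            have : ((v 0 : ℂ) * τ + v 1).im = v 0 * τ.im := by simp
            rw [this, abs_mul, abs_of_pos τ.im_pos]
            nlinarith [τ.im_pos]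
          have := τ.im_pos
          gcongr
        have h5 : Tendsto (fun τ : ℍ => w (v 0) (v 1) * EisensteinSeries.eisSummand k v τ)
            atImInfty (𝓝 0) := by
          simpa using (tendsto_zero_iff_norm_tendsto_zero.mpr h1).const_mul (w (v 0) (v 1))
        exact h5.mono_left inf_le_left
    · filter_upwards [mem_inf_of_right (mem_principal_self _)] with τ hτ v
      have h := EisensteinSeries.summand_bound_of_mem_verticalStrip (k := k) (by positivity) v
        one_pos hτ
      rw [norm_mul, EisensteinSeries.eisSummand, norm_zpow]
      refine (mul_le_of_le_one_left (by positivity) (hw _ _)).trans ?_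
      rwa [← Real.rpow_intCast, Int.cast_neg, Int.cast_natCast]
  rw [Metric.tendsto_nhds] at hstrip ⊢
  intro ε hε
  have h := hstrip ε hε
  rw [eventually_inf_principal, Filter.Eventually, atImInfty_mem] at h
  obtain ⟨A, hA⟩ := h
  rw [Filter.Eventually, atImInfty_mem]
  refine ⟨max A 1, fun τ hτ => ?_⟩
  obtain ⟨n, hn⟩ := ModularGroup_T_zpow_mem_verticalStrip τ (N := 4) (by norm_num)
  have him : (ModularGroup.T ^ ((4 : ℕ) * n) • τ).im = τ.im := by
    rw [modular_T_zpow_smul, vadd_im]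
  have h2 := hA (ModularGroup.T ^ ((4 : ℕ) * n) • τ) (by rw [him]; exact (le_max_left _ _).trans hτ)
    ⟨by exact_mod_cast hn.1, by rw [him]; exact (le_max_right _ _).trans hτ⟩
  have h3 := latticeSum_T_zpow_smul hper k n τ
  rw [Nat.cast_ofNat, h3] at h2
  exact h2

/-! ### Eisenstein series of level four and odd weight -/

theorem chiInt_even {n : ℤ} (h : n % 2 = 0) : chiInt n = 0 := by
  rcases (by omega : n % 4 = 0 ∨ n % 4 = 2) with h | h
  exacts [chiInt_of_zero h, chiInt_of_two h]

theorem chiInt_cases (n : ℤ) : chiInt n = 0 ∨ chiInt n = 1 ∨ chiInt n = -1 := by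
  rcases (by omega : n % 2 = 0 ∨ n % 4 = 1 ∨ n % 4 = 3) with h | h | h
  · exact Or.inl (chiInt_even h)
  · exact Or.inr (Or.inl (chiInt_of_one h))
  · exact Or.inr (Or.inr (chiInt_of_three h))

theorem norm_chiInt_le (n : ℤ) : ‖chiInt n‖ ≤ 1 := by
  rcases chiInt_cases n with h | h | h <;> simp [h]

theorem chiInt_pow_odd {k : ℕ} (hk : Odd k) (n : ℤ) : chiInt n ^ k = chiInt n := by
  rcases chiInt_cases n with h | h | h
  · rw [h, zero_pow hk.pos.ne']
  · rw [h, one_pow]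
  · rw [h, hk.neg_one_pow]

theorem chiInt_add_four_mul (m l : ℤ) : chiInt (m + 4 * l) = chiInt m :=
  chiInt_congr (by omega)

/-- The sum `∑_{d ≠ 0} χ_{-4}(d) d^{-k}`, which is `2 L(k, χ_{-4})` for odd `k`. -/
noncomputable def chiSum (k : ℕ) : ℂ := ∑' d : ℤ, chiInt d * (d : ℂ) ^ (-(k : ℤ))

/-- The Eisenstein series `∑ χ_{-4}(c) (cτ + d)^{-k}`, supported at the cusp `0`. -/
noncomputable def eisZero (k : ℕ) : ℍ → ℂ := latticeSum (fun c _ => chiInt c) k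

/-- The Eisenstein series `∑ χ_{-4}(d) (4cτ + d)^{-k}`, supported at the cusp `∞`. -/
noncomputable def eisInfty (k : ℕ) : ℍ → ℂ :=
  latticeSum (fun c d => if c % 4 = 0 then chiInt d else 0) k

theorem levelFour_eisZero {k : ℕ} (hk : 3 ≤ k) (hodd : Odd k) :
    LevelFour k 0 (-chiSum k) (eisZero k) := by
  constructor
  · intro γ hγ
    rw [eisZero, latticeSum_slash, chiInt_pow_odd hodd]
    ext τ
    rw [Pi.smul_apply, latticeSum, latticeSum, smul_eq_mul, ← tsum_mul_left]
    refine tsum_congr fun v => ?_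
    obtain ⟨c, hc⟩ := Int.dvd_of_emod_eq_zero hγ
    rw [show v 0 * γ 1 1 - v 1 * γ 1 0 = v 0 * γ 1 1 + 4 * (-v 1 * c) by rw [hc]; ring,
      chiInt_add_four_mul, chiInt_mul]
    ring
  · intro γ
    rw [eisZero, latticeSum_slash]
    have h := tendsto_latticeSum
      (w := fun c d => (fun c _ => chiInt c) (c * γ 1 1 - d * γ 1 0) (-(c * γ 0 1) + d * γ 0 0))
      (fun _ _ => norm_chiInt_le _) (fun c d n => by
        simp only
        rw [show c * γ 1 1 - (d - 4 * n) * γ 1 0 = c * γ 1 1 - d * γ 1 0 + 4 * (n * γ 1 0) by ring,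
          chiInt_add_four_mul]) hk
    convert h using 2
    have : ∀ d : ℤ, chiInt (0 * γ 1 1 - d * γ 1 0) * (d : ℂ) ^ (-(k : ℤ)) =
        -chiInt (γ 1 0) * (chiInt d * (d : ℂ) ^ (-(k : ℤ))) := fun d => by
      rw [zero_mul, zero_sub, chiInt_neg, chiInt_mul]; ring
    simp only [this]
    rw [tsum_mul_left, cuspVal, ← chiSum, chiInt_pow_odd hodd, chiInt_pow_odd hodd]
    split_ifs with h4
    · rw [chiInt_of_zero h4]; simp
    · ring

theorem levelFour_eisInfty {k : ℕ} (hk : 3 ≤ k) (hodd : Odd k) :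
    LevelFour k (chiSum k) 0 (eisInfty k) := by
  have hper : ∀ m l : ℤ, (m + 4 * l) % 4 = m % 4 := fun m l => by omega
  have hneg : ∀ m : ℤ, (-m) % 4 = 0 ↔ m % 4 = 0 := fun m => by omega
  constructor
  · intro γ hγ
    rw [eisInfty, latticeSum_slash, chiInt_pow_odd hodd]
    ext τ
    rw [Pi.smul_apply, latticeSum, latticeSum, smul_eq_mul, ← tsum_mul_left]
    refine tsum_congr fun v => ?_
    obtain ⟨c, hc⟩ := Int.dvd_of_emod_eq_zero hγ
    have hdet := det_eq_one γ
    have h0 : (v 0 * γ 1 1 - v 1 * γ 1 0) % 4 = 0 ↔ v 0 % 4 = 0 := by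
      rw [show v 0 * γ 1 1 - v 1 * γ 1 0 = v 0 * γ 1 1 + 4 * (-v 1 * c) by rw [hc]; ring, hper]
      constructor
      · intro h
        have h1 : v 0 = v 0 * γ 1 1 * γ 0 0 + 4 * (-(v 0 * γ 0 1 * c)) := by
          linear_combination (-v 0) * hdet - v 0 * γ 0 1 * hc
        rw [h1, hper, Int.mul_emod, h]
        simp
      · intro h
        rw [Int.mul_emod, h]
        simp
    simp only [h0]
    split_ifs with h
    · obtain ⟨m, hm⟩ := Int.dvd_of_emod_eq_zero h
      rw [show -(v 0 * γ 0 1) + v 1 * γ 0 0 = v 1 * γ 0 0 + 4 * (-(m * γ 0 1)) by rw [hm]; ring,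
        chiInt_add_four_mul, chiInt_mul, chiInt_zero_zero_eq hγ]
      ring
    · simp
  · intro γ
    rw [eisInfty, latticeSum_slash]
    have h := tendsto_latticeSum
      (w := fun c d => (fun c d => if c % 4 = 0 then chiInt d else 0)
        (c * γ 1 1 - d * γ 1 0) (-(c * γ 0 1) + d * γ 0 0))
      (fun c d => by
        simp only
        split_ifs
        · exact norm_chiInt_le _
        · simp) (fun c d n => by
        simp only
        rw [show c * γ 1 1 - (d - 4 * n) * γ 1 0 = c * γ 1 1 - d * γ 1 0 + 4 * (n * γ 1 0) by ring,
          show -(c * γ 0 1) + (d - 4 * n) * γ 0 0 =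
            -(c * γ 0 1) + d * γ 0 0 + 4 * (-(n * γ 0 0)) by ring,
          chiInt_add_four_mul, hper]) hk
    convert h using 2
    have : ∀ d : ℤ, (if (0 * γ 1 1 - d * γ 1 0) % 4 = 0 then chiInt (-(0 * γ 0 1) + d * γ 0 0)
        else 0) * (d : ℂ) ^ (-(k : ℤ)) =
        (if γ 1 0 % 4 = 0 then chiInt (γ 0 0) else 0) * (chiInt d * (d : ℂ) ^ (-(k : ℤ))) :=
      fun d => by
        rw [zero_mul, zero_mul, neg_zero, zero_add, zero_sub, chiInt_mul]
        simp only [hneg]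
        by_cases h4 : γ 1 0 % 4 = 0
        · rw [if_pos h4, if_pos (by rw [Int.mul_emod, h4]; simp)]
          ring
        · rw [if_neg h4, zero_mul]
          split_ifs with h5
          · -- If `4 ∣ d c` and `4 ∤ c`, then `d` is even.
            have h6 : d % 2 = 0 := by
              by_contra h6
              have h7 : IsCoprime (4 : ℤ) d := by
                have : IsCoprime (2 : ℤ) d := ⟨-(d / 2), 1, by omega⟩
                simpa using this.pow_left (m := 2)
              exact h4 (Int.emod_eq_zero_of_dvd
                (h7.dvd_of_dvd_mul_left (Int.dvd_of_emod_eq_zero h5)))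
            rw [chiInt_even h6]; simp
          · simp
    simp only [this]
    rw [tsum_mul_left, cuspVal, ← chiSum, chiInt_pow_odd hodd, mul_zero]
    split_ifs <;> simp

/-! ### Fourier expansions in odd weight -/

/-- A double series over `c` and `m` in the powers `r^{cm}`, collected according to `n = cm`. -/
theorem tsum_prod_pow_eq_tsum_divisors {u v : ℕ → ℂ} (hu : ∀ n, ‖u n‖ ≤ 1) (hv : ∀ n, ‖v n‖ ≤ 1)
    (k : ℕ) {r : ℂ} (hr : ‖r‖ < 1) :
    ∑' c : ℕ+, u c * ∑' m : ℕ+, v m * (m : ℂ) ^ k * r ^ ((c : ℕ) * m) =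
      ∑' n : ℕ+, (∑ d ∈ (n : ℕ).divisors, (u (n / d) * v d) * (d : ℂ) ^ k) * r ^ (n : ℕ) := by
  have hs : Summable fun x : ℕ+ × ℕ+ =>
      u x.1 * (v x.2 * (x.2 : ℂ) ^ k * r ^ ((x.1 : ℕ) * x.2)) := by
    refine Summable.of_norm_bounded (summable_prod_mul_pow k hr).norm fun x => ?_
    rw [norm_mul, norm_mul, norm_mul, norm_mul, ← mul_assoc, ← mul_assoc]
    gcongr
    exact mul_le_of_le_one_left (norm_nonneg _) (mul_le_one₀ (hu _) (norm_nonneg _) (hv _))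
  simp_rw [← tsum_mul_left]
  rw [← hs.tsum_prod, ← sigmaAntidiagonalEquivProd.tsum_eq]
  refine (sigmaAntidiagonalEquivProd.summable_iff.mpr hs).tsum_sigma.trans ?_
  refine tsum_congr fun n => ?_
  simp only [Function.comp_def, sigmaAntidiagonalEquivProd, divisorsAntidiagonalFactors,
    PNat.mk_coe, Equiv.coe_fn_mk]
  rw [tsum_fintype, Finset.univ_eq_attach,
    (n : ℕ).divisorsAntidiagonal.sum_attach
      fun x : ℕ × ℕ => u x.1 * (v x.2 * (x.2 : ℂ) ^ k * r ^ (x.1 * x.2)),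
    Nat.sum_divisorsAntidiagonal' fun x y => u x * (v y * (y : ℂ) ^ k * r ^ (x * y)),
    Finset.sum_mul]
  refine Finset.sum_congr rfl fun d hd => ?_
  rw [Nat.div_mul_cancel (Nat.dvd_of_mem_divisors hd)]
  ring

/-- The constant in Lipschitz' formula. -/
noncomputable def lipschitzConst (k : ℕ) : ℂ :=
  (-2 * Real.pi * Complex.I) ^ k / (k - 1).factorial

/-- Lipschitz' formula. -/
theorem tsum_add_int_zpow {k : ℕ} (hk : 2 ≤ k) (σ : ℍ) :
    ∑' d : ℤ, ((σ : ℂ) + d) ^ (-(k : ℤ)) =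
      lipschitzConst k * ∑' m : ℕ+, (m : ℂ) ^ (k - 1) * nome σ ^ (m : ℕ) := by
  have h := EisensteinSeries.qExpansion_identity_pnat (k := k - 1) (by omega) σ
  rw [show k - 1 + 1 = k by omega] at h
  simp only [one_div] at h
  simpa [zpow_neg, lipschitzConst, nome] using h

theorem summable_add_int_zpow {k : ℕ} (hk : 2 ≤ k) (σ : ℂ) :
    Summable fun d : ℤ => (σ + d) ^ (-(k : ℤ)) := by
  have h := EisensteinSeries.linear_right_summable σ 1 (k := k) (by exact_mod_cast hk)
  simpa [zpow_neg] using h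

/-- For odd `k` and odd weights, the terms with `c < 0` and with `c > 0` contribute equally. -/
theorem latticeSum_eq {w : ℤ → ℤ → ℂ} (hw : ∀ c d, ‖w c d‖ ≤ 1)
    (hneg : ∀ c d, w (-c) (-d) = -w c d) {k : ℕ} (hk : 3 ≤ k) (hodd : Odd k) (τ : ℍ) :
    latticeSum w k τ = (∑' d : ℤ, w 0 d * (d : ℂ) ^ (-(k : ℤ))) +
      2 * ∑' c : ℕ+, ∑' d : ℤ, w (c : ℕ) d * (((c : ℕ) : ℂ) * τ + d) ^ (-(k : ℤ)) := by
  have hs : Summable fun x : ℤ × ℤ => w x.1 x.2 * ((x.1 : ℂ) * τ + x.2) ^ (-(k : ℤ)) := by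
    have := (finTwoArrowEquiv ℤ).symm.summable_iff.mpr (summable_latticeSum hw hk τ)
    simpa [Function.comp_def, EisensteinSeries.eisSummand] using this
  have h1 : latticeSum w k τ = ∑' x : ℤ × ℤ, w x.1 x.2 * ((x.1 : ℂ) * τ + x.2) ^ (-(k : ℤ)) := by
    rw [latticeSum, ← (finTwoArrowEquiv ℤ).symm.tsum_eq]
    simp [EisensteinSeries.eisSummand]
  rw [h1, hs.tsum_prod, tsum_int_eq_zero_add_two_mul_tsum_pnat _ hs.prod]
  · simp
  · intro c
    dsimp only
    rw [← (Equiv.neg ℤ).tsum_eq]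
    refine tsum_congr fun d => ?_
    rw [Equiv.neg_apply, hneg]
    push_cast
    rw [show (-(c : ℂ) * τ + -d) = -(c * τ + d) by ring, Odd.neg_zpow (by
      rw [odd_neg]; exact_mod_cast hodd)]
    ring

theorem nome_natCast_mul (n : ℕ) (τ : ℂ) : nome (n * τ) = nome τ ^ n := by
  rw [nome, nome, ← Complex.exp_nat_mul]
  congr 1
  ring

theorem norm_chi_le (n : ℕ) : ‖(chi n : ℂ)‖ ≤ 1 := by
  rw [chi_eq_chiInt]; exact norm_chiInt_le _

theorem natMul_tau_eq (c : ℕ+) (τ : ℍ) : ((c : ℕ) : ℂ) * τ = dilate c τ := (coe_dilate c τ).symm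

/-- The Fourier expansion of `eisZero`, by Lipschitz' formula in each row `c`. -/
theorem eisZero_eq {k : ℕ} (hk : 3 ≤ k) (hodd : Odd k) (τ : ℍ) :
    eisZero k τ = 2 * lipschitzConst k * ∑' n : ℕ+,
      (∑ d ∈ (n : ℕ).divisors, (chi ((n : ℕ) / d) : ℂ) * (d : ℂ) ^ (k - 1)) *
        nome τ ^ (n : ℕ) := by
  rw [eisZero, latticeSum_eq (fun _ _ => norm_chiInt_le _) (fun c d => chiInt_neg c) hk hodd]
  have h0 : ∑' d : ℤ, chiInt 0 * (d : ℂ) ^ (-(k : ℤ)) = 0 := by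
    rw [chiInt_of_zero (by norm_num)]; simp
  have h1 : ∀ c : ℕ+, ∑' d : ℤ, chiInt (c : ℕ) * (((c : ℕ) : ℂ) * τ + d) ^ (-(k : ℤ)) =
      lipschitzConst k * ((chi c : ℂ) * ∑' m : ℕ+, (1 : ℂ) * (m : ℂ) ^ (k - 1) *
        nome τ ^ ((c : ℕ) * m)) := fun c => by
    rw [tsum_mul_left, natMul_tau_eq, tsum_add_int_zpow (by omega), ← natMul_tau_eq,
      nome_natCast_mul, chi_eq_chiInt]
    simp only [one_mul, pow_mul]
    ring
  rw [h0, zero_add]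
  simp only [h1]
  rw [tsum_mul_left, tsum_prod_pow_eq_tsum_divisors (v := fun _ => 1) norm_chi_le (by simp) (k - 1)
    (norm_nome_lt_one τ.im_pos), mul_assoc]
  simp

theorem I_pow_sub_neg_I_pow (m : ℕ) :
    Complex.I ^ m - (-Complex.I) ^ m = 2 * Complex.I * chi m := by
  have h1 : Complex.I ^ m = Complex.I ^ (m % 4) := by
    conv_lhs => rw [← Nat.div_add_mod m 4, pow_add, pow_mul, Complex.I_pow_four, one_pow, one_mul]
  have h2 : (-Complex.I) ^ m = (-Complex.I) ^ (m % 4) := by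
    conv_lhs => rw [← Nat.div_add_mod m 4, pow_add, pow_mul,
      show (-Complex.I) ^ 4 = 1 by rw [neg_pow, Complex.I_pow_four]; norm_num, one_pow, one_mul]
  rw [h1, h2, chi_eq_chiInt]
  have h : m % 4 = 0 ∨ m % 4 = 1 ∨ m % 4 = 2 ∨ m % 4 = 3 := by omega
  rcases h with h | h | h | h
  · rw [chiInt_of_zero (by omega), h]; simp
  · rw [chiInt_of_one (by omega), h]; ring
  · rw [chiInt_of_two (by omega), h]; ring
  · rw [chiInt_of_three (by omega), h, neg_pow, Complex.I_pow_three]; ring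

theorem nome_add_quarter (σ : ℂ) : nome (σ + 1 / 4) = Complex.I * nome σ := by
  have h : Complex.exp (Real.pi / 2 * Complex.I) = Complex.I := Complex.exp_pi_div_two_mul_I
  rw [nome, nome, ← h, ← Complex.exp_add, h]
  congr 1
  ring

theorem nome_add_three_quarters (σ : ℂ) : nome (σ + 3 / 4) = -Complex.I * nome σ := by
  rw [show σ + 3 / 4 = σ + 1 / 4 + 1 / 4 + 1 / 4 by ring, nome_add_quarter, nome_add_quarter,
    nome_add_quarter]
  linear_combination Complex.I * nome σ * Complex.I_mul_I

theorem summable_pow_mul_pow (k : ℕ) {r : ℂ} (hr : ‖r‖ < 1) :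
    Summable fun m : ℕ+ => (m : ℂ) ^ k * r ^ (m : ℕ) := by
  have h : Summable fun m : ℕ => (m : ℂ) ^ k * r ^ m :=
    summable_pow_mul_geometric_of_norm_lt_one k hr
  exact h.comp_injective PNat.coe_injective

/-- Lipschitz' formula twisted by `χ_{-4}`; the factor `2i` is the Gauss sum. -/
theorem tsum_chiInt_mul_zpow {k : ℕ} (hk : 2 ≤ k) (σ : ℍ) :
    ∑' d : ℤ, chiInt d * (4 * (σ : ℂ) + d) ^ (-(k : ℤ)) =
      (4 ^ k)⁻¹ * lipschitzConst k * (2 * Complex.I) *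
        ∑' m : ℕ+, (chi m : ℂ) * (m : ℂ) ^ (k - 1) * nome σ ^ (m : ℕ) := by
  have hs : Summable fun d : ℤ => chiInt d * (4 * (σ : ℂ) + d) ^ (-(k : ℤ)) := by
    refine Summable.of_norm_bounded (summable_add_int_zpow hk (4 * (σ : ℂ))).norm fun d => ?_
    rw [norm_mul]
    exact mul_le_of_le_one_left (norm_nonneg _) (norm_chiInt_le _)
  rw [← (Int.divModEquiv 4).symm.tsum_eq,
    ((Int.divModEquiv 4).symm.summable_iff.mpr hs).tsum_prod (f := fun x =>
      chiInt ((Int.divModEquiv 4).symm x) *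
        (4 * (σ : ℂ) + ((Int.divModEquiv 4).symm x : ℤ)) ^ (-(k : ℤ)))]
  have hpt : ∀ t : ℝ, (((t : ℝ) +ᵥ σ : ℍ) : ℂ) = σ + t := fun t => by
    rw [coe_vadd, add_comm]
  have hterm : ∀ n : ℤ, ∑' r : Fin 4, chiInt ((Int.divModEquiv 4).symm (n, r)) *
      (4 * (σ : ℂ) + ((Int.divModEquiv 4).symm (n, r) : ℤ)) ^ (-(k : ℤ)) =
      (4 ^ k)⁻¹ * (((((1 / 4 : ℝ) +ᵥ σ : ℍ) : ℂ) + n) ^ (-(k : ℤ)) -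
        ((((3 / 4 : ℝ) +ᵥ σ : ℍ) : ℂ) + n) ^ (-(k : ℤ))) := fun n => by
    rw [tsum_fintype, Fin.sum_univ_four]
    simp only [Int.divModEquiv, Equiv.coe_fn_symm_mk, Fin.val_zero, Fin.val_one, Fin.val_two,
      show ((3 : Fin 4) : ℕ) = 3 from rfl]
    rw [chiInt_of_zero (by push_cast; omega), chiInt_of_one (by push_cast; omega),
      chiInt_of_two (by push_cast; omega), chiInt_of_three (by push_cast; omega), hpt, hpt]
    have e : ∀ x : ℂ, (4 * x) ^ (-(k : ℤ)) = (4 ^ k)⁻¹ * x ^ (-(k : ℤ)) := fun x => by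
      rw [mul_zpow, zpow_neg, zpow_natCast]
    push_cast
    rw [show 4 * (σ : ℂ) + (n * 4 + 1) = 4 * (σ + 1 / 4 + n) by ring,
      show 4 * (σ : ℂ) + (n * 4 + 3) = 4 * (σ + 3 / 4 + n) by ring, e, e]
    ring
  simp only [hterm]
  have hn : ‖nome σ‖ < 1 := norm_nome_lt_one σ.im_pos
  have hn1 : ‖Complex.I * nome σ‖ < 1 := by simpa using hn
  have hn2 : ‖-Complex.I * nome σ‖ < 1 := by simpa using hn
  rw [tsum_mul_left, (summable_add_int_zpow hk _).tsum_sub (summable_add_int_zpow hk _),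
    tsum_add_int_zpow hk, tsum_add_int_zpow hk, hpt, hpt]
  push_cast
  rw [nome_add_quarter, nome_add_three_quarters, ← mul_sub,
    ← (summable_pow_mul_pow _ hn1).tsum_sub (summable_pow_mul_pow _ hn2), mul_assoc _ (2 * _) _,
    ← mul_assoc, ← tsum_mul_left (a := 2 * Complex.I)]
  congr 1
  refine tsum_congr fun m => ?_
  rw [mul_pow, mul_pow]
  linear_combination (m : ℂ) ^ (k - 1) * nome σ ^ (m : ℕ) * I_pow_sub_neg_I_pow m

/-- The Fourier expansion of `eisInfty`, by the twisted Lipschitz formula in each row `4c`. -/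
theorem eisInfty_eq {k : ℕ} (hk : 3 ≤ k) (hodd : Odd k) (τ : ℍ) :
    eisInfty k τ = chiSum k + 2 * ((4 ^ k)⁻¹ * lipschitzConst k * (2 * Complex.I)) * ∑' n : ℕ+,
      (∑ d ∈ (n : ℕ).divisors, (chi d : ℂ) * (d : ℂ) ^ (k - 1)) * nome τ ^ (n : ℕ) := by
  have hneg : ∀ m : ℤ, (-m) % 4 = 0 ↔ m % 4 = 0 := fun m => by omega
  rw [eisInfty, latticeSum_eq (fun c d => by
      split_ifs
      · exact norm_chiInt_le _
      · simp) (fun c d => by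
      simp only [hneg, chiInt_neg]
      split_ifs <;> simp) hk hodd]
  simp only [Int.zero_emod, if_true]
  rw [← chiSum]
  congr 1
  rw [mul_assoc 2]
  congr 1
  have hinj : Function.Injective fun c : ℕ+ => 4 * c := fun a b h => mul_left_cancel h
  rw [← hinj.tsum_eq]
  · have h1 : ∀ c : ℕ+, ∑' d : ℤ, (if (((4 * c : ℕ+) : ℕ) : ℤ) % 4 = 0 then chiInt d else 0) *
        ((((4 * c : ℕ+) : ℕ) : ℂ) * τ + d) ^ (-(k : ℤ)) =
        ((4 ^ k)⁻¹ * lipschitzConst k * (2 * Complex.I)) * ((1 : ℂ) *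
          ∑' m : ℕ+, (chi m : ℂ) * (m : ℂ) ^ (k - 1) * nome τ ^ ((c : ℕ) * m)) := fun c => by
      have h4 : (((4 * c : ℕ+) : ℕ) : ℤ) % 4 = 0 := by
        rw [PNat.mul_coe]; simp
      simp only [h4, if_true]
      have h5 : (((4 * c : ℕ+) : ℕ) : ℂ) * τ = 4 * (dilate c τ : ℂ) := by
        rw [coe_dilate, PNat.mul_coe]; push_cast; ring
      rw [h5, tsum_chiInt_mul_zpow (by omega), coe_dilate, nome_natCast_mul]
      simp only [one_mul, pow_mul]
    simp only [h1]
    rw [tsum_mul_left, tsum_prod_pow_eq_tsum_divisors (u := fun _ => 1) (v := fun n => (chi n : ℂ))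
      (by simp) norm_chi_le (k - 1) (norm_nome_lt_one τ.im_pos)]
    simp
  · intro c hc
    by_cases h : ((c : ℕ) : ℤ) % 4 = 0
    · obtain ⟨m, hm⟩ : 4 ∣ (c : ℕ) := by omega
      have hm0 : 0 < m := Nat.pos_of_ne_zero (by rintro rfl; simp at hm)
      exact ⟨⟨m, hm0⟩, PNat.eq (by rw [hm]; rfl)⟩
    · exact absurd (by simp [h]) hc

/-! ### The value `L(k, χ_{-4})` -/

/-- `B_{k,χ_{-4}} = 4^{k-1} (B_k(1/4) - B_k(3/4))`, and `B_k(3/4) = -B_k(1/4)` for odd `k`. -/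
theorem bernoulliChi_eq {k : ℕ} (hodd : Odd k) :
    bernoulliChi k = 2 * 4 ^ (k - 1) * (Polynomial.bernoulli k).eval (1 / 4) := by
  -- `G t` is the generating function of the values `B_n(t) / n!`.
  let G : ℚ → PowerSeries ℚ := fun t =>
    PowerSeries.mk fun n => Polynomial.aeval t ((1 / (n.factorial : ℚ)) • Polynomial.bernoulli n)
  have hG : ∀ t : ℚ, PowerSeries.rescale 4 (G t) *
      (PowerSeries.rescale (4 : ℚ) (PowerSeries.exp ℚ) - 1) =
      (4 : ℚ) • (PowerSeries.X * PowerSeries.rescale (4 * t) (PowerSeries.exp ℚ)) := fun t => by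
    have h := congrArg (PowerSeries.rescale (4 : ℚ)) (Polynomial.bernoulli_generating_function t)
    rw [map_mul, map_sub, map_one, map_mul, PowerSeries.rescale_rescale, PowerSeries.rescale_X] at h
    rw [h, mul_assoc, PowerSeries.smul_eq_C_mul, mul_comm t]
  have hne : PowerSeries.rescale (4 : ℚ) (PowerSeries.exp ℚ) - 1 ≠ 0 := by
    intro h
    have := congrArg (PowerSeries.coeff 1) h
    simp [PowerSeries.coeff_rescale, PowerSeries.coeff_exp, PowerSeries.coeff_one] at this
  have hser : bernoulliChiSeries = (1 / 4 : ℚ) •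
      (PowerSeries.rescale 4 (G (1 / 4)) - PowerSeries.rescale 4 (G (3 / 4))) := by
    apply mul_right_cancel₀ hne
    rw [bernoulliChiSeries_mul, smul_mul_assoc, sub_mul, hG, hG, ← smul_sub, smul_smul,
      show (Finset.Icc 1 4 : Finset ℕ) = {1, 2, 3, 4} by decide]
    rw [Finset.sum_insert (by decide), Finset.sum_insert (by decide), Finset.sum_insert (by decide),
      Finset.sum_singleton, show chi 1 = 1 by decide, show chi 2 = 0 by decide,
      show chi 3 = -1 by decide, show chi 4 = 0 by decide]
    norm_num
    ring
  have hsymm : (Polynomial.bernoulli k).eval (3 / 4 : ℚ) =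
      -(Polynomial.bernoulli k).eval (1 / 4 : ℚ) := by
    rw [show (3 / 4 : ℚ) = 1 - 1 / 4 by norm_num, Polynomial.bernoulli_eval_one_sub,
      hodd.neg_one_pow]
    ring
  have hf : (k.factorial : ℚ) ≠ 0 := by exact_mod_cast Nat.factorial_ne_zero _
  obtain ⟨m, rfl⟩ := hodd
  rw [bernoulliChi, hser]
  simp only [map_smul, map_sub, PowerSeries.coeff_rescale, G, PowerSeries.coeff_mk,
    Polynomial.coe_aeval_eq_eval, hsymm, smul_eq_mul]
  rw [show 2 * m + 1 - 1 = 2 * m by omega]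
  field_simp
  ring

theorem chiInt_eq_sin (n : ℕ) : chiInt n = (Real.sin (2 * Real.pi * n * (1 / 4)) : ℂ) := by
  have h1 : Complex.sin (2 * Real.pi * n * (1 / 4)) =
      (Complex.I ^ n - (-Complex.I) ^ n) / (2 * Complex.I) := by
    have e1 : Complex.I ^ n = Complex.exp (2 * Real.pi * n * (1 / 4) * Complex.I) := by
      conv_lhs => rw [← Complex.exp_pi_div_two_mul_I, ← Complex.exp_nat_mul]
      congr 1; ring
    have e2 : (-Complex.I) ^ n = Complex.exp (-(2 * Real.pi * n * (1 / 4)) * Complex.I) := by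
      have : Complex.exp (-(Real.pi / 2 * Complex.I)) = -Complex.I := by
        rw [Complex.exp_neg, Complex.exp_pi_div_two_mul_I, Complex.inv_I]
      conv_lhs => rw [← this, ← Complex.exp_nat_mul]
      congr 1; ring
    rw [e1, e2, Complex.sin]
    generalize Complex.exp (-(2 * Real.pi * n * (1 / 4)) * Complex.I) = x
    generalize Complex.exp (2 * Real.pi * n * (1 / 4) * Complex.I) = y
    have hI0 := Complex.I_ne_zero
    field_simp
    linear_combination (x - y) * Complex.I_sq
  push_cast
  rw [h1, I_pow_sub_neg_I_pow, chi_eq_chiInt]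
  have hI0 := Complex.I_ne_zero
  field_simp

theorem summable_chiInt_mul_zpow {k : ℕ} (hk : 2 ≤ k) :
    Summable fun d : ℤ => chiInt d * (d : ℂ) ^ (-(k : ℤ)) := by
  refine Summable.of_norm_bounded (summable_add_int_zpow hk 0).norm fun d => ?_
  rw [norm_mul, zero_add]
  exact mul_le_of_le_one_left (norm_nonneg _) (norm_chiInt_le _)

theorem chiSum_eq_two_mul {k : ℕ} (hk : 2 ≤ k) (hodd : Odd k) :
    chiSum k = 2 * ∑' n : ℕ, chiInt n / (n : ℂ) ^ k := by
  have hs := summable_chiInt_mul_zpow hk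
  rw [chiSum, tsum_int_eq_zero_add_two_mul_tsum_pnat _ hs]
  · have hs' : Summable fun n : ℕ => chiInt n / (n : ℂ) ^ k := by
      have := hs.comp_injective (Nat.cast_injective (R := ℤ))
      simpa [Function.comp_def, zpow_neg, div_eq_mul_inv] using this
    rw [← tsum_zero_pnat_eq_tsum_nat hs', chiInt_of_zero (n := 0) (by norm_num)]
    simp [zpow_neg, div_eq_mul_inv, chiInt_of_zero]
  · intro d
    dsimp only
    rw [chiInt_neg, Int.cast_neg, Odd.neg_zpow (by rw [odd_neg]; exact_mod_cast hodd)]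
    ring

/-- The value of `L(k, χ_{-4})` for odd `k`, from the Fourier series of the Bernoulli polynomial
`B_k` at `1/4`. -/
theorem chiSum_eq {k m : ℕ} (hm : m ≠ 0) (hk : k = 2 * m + 1) :
    chiSum k = (-1) ^ (m + 1) * (2 * Real.pi) ^ k / k.factorial *
      (((Polynomial.bernoulli k).eval (1 / 4) : ℚ) : ℂ) := by
  subst hk
  have h := hasSum_one_div_nat_pow_mul_sin hm (x := 1 / 4) (by constructor <;> norm_num)
  have h2 := (Complex.hasSum_ofReal.mpr h).tsum_eq
  rw [chiSum_eq_two_mul (by omega) ⟨m, rfl⟩]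
  have h3 : ∀ n : ℕ, chiInt n / (n : ℂ) ^ (2 * m + 1) =
      ((1 / (n : ℝ) ^ (2 * m + 1) * Real.sin (2 * Real.pi * n * (1 / 4)) : ℝ) : ℂ) := fun n => by
    rw [chiInt_eq_sin]; push_cast; ring
  have h4 : Polynomial.eval (1 / 4 : ℝ) (Polynomial.map (algebraMap ℚ ℝ)
      (Polynomial.bernoulli (2 * m + 1))) =
      (((Polynomial.bernoulli (2 * m + 1)).eval (1 / 4) : ℚ) : ℝ) := by
    have := Polynomial.eval_map_apply (f := algebraMap ℚ ℝ) (p := Polynomial.bernoulli (2 * m + 1))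
      (1 / 4 : ℚ)
    simpa using this
  simp only [h3]
  rw [h2, h4]
  push_cast
  ring

theorem chiSum_ne_zero {k : ℕ} (hk : 2 ≤ k) (hodd : Odd k) : chiSum k ≠ 0 := by
  have h := DirichletCharacter.LSeries_ne_zero_of_one_lt_re chiNegFour (s := k)
    (by simp; omega)
  rw [chiSum_eq_two_mul hk hodd]
  refine mul_ne_zero two_ne_zero ?_
  convert h using 1
  refine tsum_congr fun n => ?_
  rcases eq_or_ne n 0 with rfl | hn
  · simp [chiInt_of_zero]
  · rw [LSeries.term_of_ne_zero hn, Complex.cpow_natCast]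
    congr 1

/-- The relation between `L(k, χ_{-4})` and `B_{k, χ_{-4}}` for odd `k`. -/
theorem chiSum_mul {k : ℕ} (hk : 3 ≤ k) (hodd : Odd k) :
    2 * (k : ℂ) * 4 ^ (k - 1) * chiSum k =
      -Complex.I * lipschitzConst k * (bernoulliChi k : ℂ) := by
  obtain ⟨m, hm⟩ := hodd
  have hf : ((k - 1).factorial : ℂ) ≠ 0 := by exact_mod_cast Nat.factorial_ne_zero _
  have hk0 : (k : ℂ) ≠ 0 := by exact_mod_cast (by omega : k ≠ 0)
  have hfk : (k.factorial : ℂ) = k * (k - 1).factorial := by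
    exact_mod_cast (Nat.mul_factorial_pred (by omega)).symm
  have hI : (-2 * Real.pi * Complex.I) ^ k = (2 * Real.pi) ^ k * (-Complex.I * (-1) ^ m) := by
    rw [show (-2 * Real.pi * Complex.I : ℂ) = (2 * Real.pi) * (-Complex.I) by ring, mul_pow]
    congr 1
    rw [hm, pow_succ, pow_mul, neg_sq, Complex.I_sq]
    ring
  rw [chiSum_eq (by omega) hm, bernoulliChi_eq ⟨m, hm⟩, lipschitzConst, hfk, hI]
  push_cast
  field_simp
  linear_combination (-(((Polynomial.bernoulli k).eval (1 / 4) : ℚ) : ℂ) * (-1) ^ m) * Complex.I_sq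

theorem bernoulliChi_ne_zero {k : ℕ} (hk : 3 ≤ k) (hodd : Odd k) : (bernoulliChi k : ℂ) ≠ 0 := by
  intro h
  have h1 := chiSum_mul hk hodd
  rw [h, mul_zero] at h1
  have hk0 : (k : ℂ) ≠ 0 := by exact_mod_cast (by omega : k ≠ 0)
  exact mul_ne_zero (mul_ne_zero (mul_ne_zero two_ne_zero hk0) (pow_ne_zero _ (by norm_num)))
    (chiSum_ne_zero (by omega) hodd) h1

/-! ### The Eisenstein part in odd weight -/

theorem eisE2_eq {k : ℕ} (hk : 3 ≤ k) (hodd : Odd k) (τ : ℍ) :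
    eisE2 k τ = (chiSum k)⁻¹ * eisInfty k τ := by
  have hB := bernoulliChi_ne_zero hk hodd
  have hL := chiSum_ne_zero (by omega : 2 ≤ k) hodd
  have hrel := chiSum_mul hk hodd
  have h4 : (4 : ℂ) ^ k = 4 ^ (k - 1) * 4 := by rw [← pow_succ, show k - 1 + 1 = k by omega]
  rw [eisE2, eisInfty_eq hk hodd, h4]
  generalize (∑' n : ℕ+, (∑ d ∈ (n : ℕ).divisors, (chi d : ℂ) * (d : ℂ) ^ (k - 1)) *
    nome τ ^ (n : ℕ)) = S
  have h40 : (4 : ℂ) ^ (k - 1) ≠ 0 := pow_ne_zero _ (by norm_num)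
  have e : 2 * (k : ℂ) / (bernoulliChi k : ℂ) =
      -Complex.I * lipschitzConst k / (4 ^ (k - 1) * chiSum k) := by
    rw [div_eq_div_iff hB (mul_ne_zero h40 hL)]
    linear_combination hrel
  rw [e]
  field_simp
  ring

theorem eisE1_eq {k : ℕ} (hk : 3 ≤ k) (hodd : Odd k) (τ : ℍ) :
    eisE1 k τ = Complex.I / (2 * 4 ^ (k - 1) * chiSum k) * eisZero k τ := by
  have hB := bernoulliChi_ne_zero hk hodd
  have hL := chiSum_ne_zero (by omega : 2 ≤ k) hodd
  have hrel := chiSum_mul hk hodd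
  rw [eisE1, eisZero_eq hk hodd]
  generalize (∑' n : ℕ+, (∑ d ∈ (n : ℕ).divisors, (chi ((n : ℕ) / d) : ℂ) * (d : ℂ) ^ (k - 1)) *
    nome τ ^ (n : ℕ)) = S
  have h40 : (4 : ℂ) ^ (k - 1) ≠ 0 := pow_ne_zero _ (by norm_num)
  have e : 2 * (k : ℂ) / (bernoulliChi k : ℂ) =
      -Complex.I * lipschitzConst k / (4 ^ (k - 1) * chiSum k) := by
    rw [div_eq_div_iff hB (mul_ne_zero h40 hL)]
    linear_combination hrel
  rw [e]
  field_simp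

theorem LevelFour.smul_add_smul {k : ℕ} {a b a' b' : ℂ} {f g : ℍ → ℂ}
    (hf : LevelFour k a b f) (hg : LevelFour k a' b' g) (x y : ℂ) :
    LevelFour k (x * a + y * a') (x * b + y * b') (x • f + y • g) := by
  constructor
  · intro γ hγ
    rw [SlashAction.add_slash, ModularForm.SL_smul_slash, ModularForm.SL_smul_slash,
      hf.slash γ hγ, hg.slash γ hγ, smul_add, smul_comm x, smul_comm y]
  · intro γ
    rw [SlashAction.add_slash, ModularForm.SL_smul_slash, ModularForm.SL_smul_slash]
    have hval : cuspVal k (x * a + y * a') (x * b + y * b') γ =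
        x * cuspVal k a b γ + y * cuspVal k a' b' γ := by
      unfold cuspVal
      split_ifs <;> ring
    rw [hval]
    exact ((hf.tendsto γ).const_mul x).add ((hg.tendsto γ).const_mul y)

/-- The Eisenstein series of odd weight and level four with the value `1` at `∞`, the value
`ε (-i/2)^k` at `0` and the value `0` at `1/2`. -/
theorem levelFour_oddEis {k : ℕ} (hk : 3 ≤ k) (hodd : Odd k) (ε : ℂ) :
    LevelFour k 1 (ε * (-Complex.I / 2) ^ k)
      (fun τ : ℍ => eisE2 k τ + ε * (-4) ^ ((k - 1) / 2) * eisE1 k τ) := by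
  have hL := chiSum_ne_zero (by omega : 2 ≤ k) hodd
  have h := (levelFour_eisInfty hk hodd).smul_add_smul (levelFour_eisZero hk hodd)
    (chiSum k)⁻¹ (ε * (-4) ^ ((k - 1) / 2) * (Complex.I / (2 * 4 ^ (k - 1) * chiSum k)))
  convert! h using 1
  · field_simp; simp
  · obtain ⟨m, rfl⟩ := hodd
    rw [show 2 * m + 1 - 1 = 2 * m by omega, show 2 * m / 2 = m by omega]
    have h1 : (-Complex.I / 2) ^ (2 * m + 1) * 4 ^ (2 * m) = (-4) ^ m * (-Complex.I / 2) := by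
      rw [pow_succ, mul_right_comm, ← mul_pow, pow_mul]
      congr 2
      linear_combination 4 * Complex.I_sq
    have h40 : (4 : ℂ) ^ (2 * m) ≠ 0 := pow_ne_zero _ (by norm_num)
    rw [(eq_div_iff h40).mpr h1, mul_zero, zero_add]
    field_simp
  · ext τ
    rw [eisE2_eq hk hodd, eisE1_eq hk hodd]
    simp only [Pi.add_apply, Pi.smul_apply, smul_eq_mul]
    ring

/-- For odd `k` the Eisenstein part of the formula is a combination of forms of level four. -/
theorem eisenstein_part_odd {p k j : ℕ} (hp : p.Prime) (hk : 1 < k) (hodd : Odd k) :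
    ∃ K₁ K₂ : ℍ → ℂ, LevelFour k 1 ((chi p : ℂ) ^ j * (-Complex.I / 2) ^ k) K₁ ∧
      LevelFour k 1 ((chi p : ℂ) ^ (j + k) * (-Complex.I / 2) ^ k) K₂ ∧
      ∀ τ : ℍ, coeffOne p k j * F p k j 1 τ + coeffP p k j * F p k j p τ =
        coeffOne p k j * K₁ τ + coeffP p k j * K₂ (dilate ⟨p, hp.pos⟩ τ) := by
  have hk3 : 3 ≤ k := by
    obtain ⟨m, rfl⟩ := hodd; omega
  refine ⟨_, _, levelFour_oddEis hk3 hodd _, levelFour_oddEis hk3 hodd _, fun τ => ?_⟩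
  have hχ : (chi p : ℂ) ^ (j + k) = chi p * (chi p : ℂ) ^ j := by
    rw [pow_add, chi_eq_chiInt, chiInt_pow_odd hodd]; ring
  have h1 : (chi 1 : ℂ) = 1 := by simp [chi]
  rw [F, F, if_neg (Nat.not_even_iff_odd.mpr hodd), if_neg (Nat.not_even_iff_odd.mpr hodd), h1, hχ,
    show ((dilate ⟨p, hp.pos⟩ τ : ℍ) : ℂ) = (p : ℂ) * τ from coe_dilate _ τ]
  simp

theorem differentiableOn_eisE1 (k : ℕ) : DifferentiableOn ℂ (eisE1 k) {τ | 0 < τ.im} :=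
  (differentiableOn_tsum_nome (m := k - 1 + 1) fun n =>
    norm_divisor_sum_le (w := fun d => (chi ((n : ℕ) / d) : ℂ)) (fun _ => norm_chi_le _) (k - 1)
      n).const_mul _

theorem differentiableOn_eisE2 (k : ℕ) : DifferentiableOn ℂ (eisE2 k) {τ | 0 < τ.im} :=
  ((differentiableOn_tsum_nome (m := k - 1 + 1) fun n =>
    norm_divisor_sum_le (w := fun d => (chi d : ℂ)) norm_chi_le (k - 1) n).const_mul _).const_sub _

theorem differentiableOn_F (p k j : ℕ) {a : ℕ} (ha : 0 < a) :
    DifferentiableOn ℂ (F p k j a) {τ | 0 < τ.im} := by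
  have hmul : ∀ {f : ℂ → ℂ}, DifferentiableOn ℂ f {τ | 0 < τ.im} → ∀ {r : ℝ}, 0 < r →
      DifferentiableOn ℂ (fun τ => f ((r : ℂ) * τ)) {τ | 0 < τ.im} := fun hf r hr =>
    hf.comp (f := fun τ => (r : ℂ) * τ) (by fun_prop) fun τ hτ => by
      have hτ' : 0 < τ.im := hτ
      simp only [Set.mem_ofPred_eq, Complex.im_ofReal_mul]
      positivity
  have ha' : (0 : ℝ) < a := by exact_mod_cast ha
  unfold F
  split_ifs
  · have h1 := hmul (differentiableOn_eisE k) ha'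
    have h2 := hmul (differentiableOn_eisE k) (mul_pos two_pos ha')
    have h4 := hmul (differentiableOn_eisE k) (mul_pos four_pos ha')
    push_cast at h1 h2 h4
    simp only [mul_assoc] at h2 h4
    exact (((h1.const_mul _).sub (h2.const_mul _)).add (h4.const_mul _)).const_mul _
  · have h1 := hmul (differentiableOn_eisE1 k) ha'
    have h2 := hmul (differentiableOn_eisE2 k) ha'
    push_cast at h1 h2
    exact h2.add (h1.const_mul _)

/-! ### Representation numbers -/

theorem nome_ne_zero (τ : ℂ) : nome τ ≠ 0 := Complex.exp_ne_zero _

theorem zpow_sum_of_ne_zero {ι : Type*} {w : ℂ} (hw : w ≠ 0) (s : Finset ι) (f : ι → ℤ) :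
    w ^ (∑ i ∈ s, f i) = ∏ i ∈ s, w ^ f i := by
  classical
  induction s using Finset.induction_on with
  | empty => simp
  | insert a s ha ih => rw [Finset.sum_insert ha, Finset.prod_insert ha, zpow_add₀ hw, ih]

theorem hasSum_phi {τ : ℂ} (h : 0 < τ.im) : HasSum (fun n : ℤ => nome τ ^ (n ^ 2)) (phi τ) := by
  have h2 : 0 < (2 * τ).im := by simpa using h
  have h3 : Summable fun n : ℤ => nome τ ^ (n ^ 2) := by
    refine ((summable_jacobiTheta₂_term_iff 0 (2 * τ)).mpr h2).congr fun n => ?_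
    rw [nome, ← Complex.exp_int_mul, jacobiTheta₂_term]
    congr 1
    push_cast
    ring
  exact h3.hasSum

theorem hasSum_mul {ι κ : Type*} {f : ι → ℂ} {g : κ → ℂ} {s t : ℂ} (hf : HasSum f s)
    (hg : HasSum g t) : HasSum (fun v : ι × κ => f v.1 * g v.2) (s * t) :=
  HasSum.mul hf hg (summable_mul_of_summable_norm hf.summable.norm hg.summable.norm)

/-- The `r`-th power of a series, as a series over `r`-tuples. -/
theorem hasSum_prod_fin {f : ℤ → ℂ} {s : ℂ} (hf : HasSum f s) (r : ℕ) :
    HasSum (fun v : Fin r → ℤ => ∏ i, f (v i)) (s ^ r) := by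
  induction r with
  | zero => simp
  | succ r ih =>
    have h := hasSum_mul hf ih
    rw [← (Fin.consEquiv fun _ : Fin (r + 1) => ℤ).hasSum_iff, pow_succ']
    refine h.congr_fun fun v => ?_
    simp [Fin.prod_univ_succ, Fin.consEquiv]

theorem hasSum_z_pow {a : ℕ} (ha : 0 < a) {τ : ℂ} (h : 0 < τ.im) (r : ℕ) :
    HasSum (fun v : Fin (2 * r) → ℤ => nome τ ^ ((a : ℤ) * ∑ i, v i ^ 2)) (z a τ ^ r) := by
  have ha' : (0 : ℝ) < a := by exact_mod_cast ha
  have h1 : 0 < ((a : ℂ) * τ).im := by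
    rw [← Complex.ofReal_natCast, Complex.im_ofReal_mul]; positivity
  rw [z, ← pow_mul]
  convert! hasSum_prod_fin (hasSum_phi h1) (2 * r) using 2 with v
  rw [nome_natCast_mul, ← zpow_natCast (nome τ) a, Finset.mul_sum,
    zpow_sum_of_ne_zero (nome_ne_zero τ)]
  simp only [zpow_mul]

/-- A generating function `∑_v w^{Q(v)}` is the power series whose coefficients count the solutions
of `Q(v) = n`. -/
theorem HasSum.fiberwise_card {ι : Type*} {w s : ℂ} {Q : ι → ℤ} (hQ : ∀ v, 0 ≤ Q v)
    (h : HasSum (fun v => w ^ Q v) s) :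
    HasSum (fun n : ℕ => (Nat.card {v // Q v = n} : ℂ) * w ^ n) s := by
  have h1 := h.tsum_fiberwise fun v => (Q v).toNat
  refine h1.congr_fun fun n => ?_
  have h3 : ∀ v : {v // (Q v).toNat = n}, w ^ Q v = w ^ n := fun v => by
    have := v.2
    have := hQ v
    rw [← zpow_natCast, show (n : ℤ) = Q v by omega]
  have h4 : Nat.card {v // Q v = n} = Nat.card {v // (Q v).toNat = n} :=
    Nat.card_congr (Equiv.subtypeEquivRight fun v => by have := hQ v; omega)
  rw [h4, ← nsmul_eq_mul, ← tsum_const]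
  exact (tsum_congr h3).symm

/-- The generating function of the representation numbers. -/
theorem hasSum_repNumber {p : ℕ} (hp : 0 < p) {τ : ℂ} (hτ : 0 < τ.im) (r s : ℕ) :
    HasSum (fun n : ℕ => (repNumber p (2 * r) (2 * s) n : ℂ) * nome τ ^ n)
      (z 1 τ ^ r * z p τ ^ s) := by
  have h1 := hasSum_z_pow one_pos hτ r
  have h2 := hasSum_z_pow hp hτ s
  have h := hasSum_mul h1 h2
  simp only [← zpow_add₀ (nome_ne_zero τ), Nat.cast_one, one_mul] at h
  exact HasSum.fiberwise_card (fun v => by positivity) h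

/-! ### Quotients of holomorphic modular forms -/

/-- `f` is a holomorphic modular form of weight `k` for `Γ₀(N)` with character `χ_{-4}^k`. -/
structure IsHolomorphicForm (N k : ℕ) (f : ℍ → ℂ) : Prop where
  holo : MDiff f
  slash : ∀ γ : SL(2, ℤ), (N : ℤ) ∣ γ 1 0 → f ∣[(k : ℤ)] γ = chiInt (γ 1 1) ^ k • f
  bounded : ∀ γ : SL(2, ℤ), IsBoundedAtImInfty (f ∣[(k : ℤ)] γ)

theorem slash_T_zpow (k : ℤ) (f : ℍ → ℂ) (n : ℤ) (τ : ℍ) :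
    (f ∣[k] (ModularGroup.T ^ n)) τ = f (ModularGroup.T ^ n • τ) := by
  rw [ModularForm.SL_slash_apply, denom_eq, ModularGroup.coe_T_zpow]
  simp

/-- The width of every cusp of `Γ₀(N)` divides `N`, and `χ_{-4}` is trivial on the stabilizers when
`4 ∣ N`. -/
theorem IsHolomorphicForm.periodic {N k : ℕ} {f : ℍ → ℂ} (hf : IsHolomorphicForm N k f)
    (hN : 4 ∣ N) (γ : SL(2, ℤ)) :
    Function.Periodic ((f ∣[(k : ℤ)] γ) ∘ ofComplex) (N : ℝ) := by
  have hslash : (f ∣[(k : ℤ)] γ) ∣[(k : ℤ)] (ModularGroup.T ^ (N : ℤ)) = f ∣[(k : ℤ)] γ := by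
    have hdet := det_eq_one γ
    let σ : SL(2, ℤ) := ⟨!![1 - N * (γ 0 0 * γ 1 0), N * γ 0 0 ^ 2;
      -(N * γ 1 0 ^ 2), 1 + N * (γ 0 0 * γ 1 0)], by rw [Matrix.det_fin_two_of]; ring⟩
    have hσ : γ * ModularGroup.T ^ (N : ℤ) = σ * γ := by
      apply Subtype.ext
      rw [Matrix.SpecialLinearGroup.coe_mul, Matrix.SpecialLinearGroup.coe_mul,
        ModularGroup.coe_T_zpow]
      ext a b
      fin_cases a <;> fin_cases b <;>
        simp only [σ, Matrix.mul_apply, Fin.sum_univ_two, Fin.zero_eta, Fin.mk_one, Matrix.of_apply,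
          Matrix.cons_val_zero, Matrix.cons_val_one]
      · ring
      · linear_combination -(N * γ 0 0 : ℤ) * hdet
      · ring
      · linear_combination -(N * γ 1 0 : ℤ) * hdet
    have h1 : f ∣[(k : ℤ)] σ = f := by
      have h11 : (1 + (N : ℤ) * (γ 0 0 * γ 1 0)) % 4 = 1 := by
        obtain ⟨M, rfl⟩ := hN
        rw [Nat.cast_mul, mul_assoc]
        generalize (M : ℤ) * (γ 0 0 * γ 1 0) = x
        omega
      have h := hf.slash σ ⟨-γ 1 0 ^ 2, by simp [σ]⟩
      rwa [show σ 1 1 = 1 + (N : ℤ) * (γ 0 0 * γ 1 0) from rfl, chiInt_of_one h11, one_pow,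
        one_smul] at h
    rw [← SlashAction.slash_mul, hσ, SlashAction.slash_mul, h1]
  intro w
  by_cases! hw : 0 < w.im
  · have hw' : 0 < (w + (N : ℝ)).im := by simpa using hw
    simp only [Function.comp_apply, ofComplex_apply_of_im_pos hw', ofComplex_apply_of_im_pos hw]
    have h := congrFun hslash ⟨w, hw⟩
    rw [slash_T_zpow] at h
    rw [← h]
    refine congrArg _ (UpperHalfPlane.ext ?_)
    rw [ModularGroup.coe_T_zpow_smul_eq]
    simp
  · have hw' : (w + (N : ℝ)).im ≤ 0 := by simpa using hw
    simp only [Function.comp_apply, ofComplex_apply_of_im_nonpos hw',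
      ofComplex_apply_of_im_nonpos hw]

/-- At every cusp a holomorphic form is an analytic function of the local parameter. -/
theorem IsHolomorphicForm.exists_analyticAt {N k : ℕ} {f : ℍ → ℂ} (hf : IsHolomorphicForm N k f)
    (hN0 : 0 < N) (hN : 4 ∣ N) (γ : SL(2, ℤ)) :
    ∃ g : ℂ → ℂ, AnalyticAt ℂ g 0 ∧
      ∀ τ : ℍ, (f ∣[(k : ℤ)] γ) τ = g (nome ((τ : ℂ) / (N : ℂ))) := by
  have hN' : (0 : ℝ) < N := by exact_mod_cast hN0
  have hper := hf.periodic hN γ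
  refine ⟨_, analyticAt_cuspFunction_zero hN' hper (MDifferentiable.slash hf.holo k γ)
    (hf.bounded γ), fun τ => ?_⟩
  rw [← eq_cuspFunction τ hN'.ne' hper, Function.Periodic.qParam, nome]
  congr 2
  push_cast
  ring

/-- The quotient of two forms of the same weight and character is a modular function. A nonvanishing
denominator is assumed, so that the quotient is holomorphic on `ℍ`. -/
theorem IsHolomorphicForm.div {N k : ℕ} {f g : ℍ → ℂ} (hf : IsHolomorphicForm N k f)
    (hg : IsHolomorphicForm N k g) (hN0 : 0 < N) (hN : 4 ∣ N) (h0 : ∀ τ, g τ ≠ 0) :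
    IsModularFunction N (f / g) := by
  have hsmul : ∀ (γ : SL(2, ℤ)) (τ : ℍ),
      (f / g) (γ • τ) = (f ∣[(k : ℤ)] γ) τ / (g ∣[(k : ℤ)] γ) τ := fun γ τ => by
    have h := congrFun (ModularForm.div_slash_SL2 (k : ℤ) k γ f g) τ
    rw [sub_self, ModularForm.SL_slash_apply] at h
    simpa using h
  refine ⟨fun τ => ?_, fun γ hγ τ => ?_, fun γ => ?_⟩
  · have han : ∀ {u : ℍ → ℂ}, MDiff u → AnalyticAt ℂ (u ∘ ofComplex) (τ : ℂ) := fun hu =>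
      (UpperHalfPlane.mdifferentiable_iff.mp hu).analyticAt
        (isOpen_upperHalfPlaneSet.mem_nhds τ.im_pos)
    refine AnalyticAt.meromorphicNFAt ?_
    refine ((han hf.holo).div (han hg.holo) ?_ : AnalyticAt ℂ ((f ∘ ofComplex) / (g ∘ ofComplex)) _)
    simpa using h0 τ
  · have h10 : (N : ℤ) ∣ γ 1 0 := by
      rwa [CongruenceSubgroup.Gamma0_mem, ZMod.intCast_zmod_eq_zero_iff_dvd] at hγ
    have hodd : γ 1 1 % 2 = 1 := by
      have h4 : (4 : ℤ) ∣ γ 1 0 := (by exact_mod_cast hN : (4 : ℤ) ∣ N).trans h10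
      have hdet := det_eq_one γ
      obtain ⟨c, hc⟩ := h4
      rw [hc] at hdet
      by_contra h
      obtain ⟨d, hd⟩ : (2 : ℤ) ∣ γ 1 1 := by omega
      rw [hd] at hdet
      have : 2 * (γ 0 0 * d - γ 0 1 * (2 * c)) = 1 := by linear_combination hdet
      omega
    have hχ : chiInt (γ 1 1) ^ k ≠ 0 := pow_ne_zero _ fun h => by
      have := chiInt_sq hodd
      rw [h] at this
      norm_num at this
    rw [hsmul, hf.slash γ h10, hg.slash γ h10]
    simp [mul_div_mul_left _ _ hχ]
  · obtain ⟨u, hu, hfu⟩ := hf.exists_analyticAt hN0 hN γ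
    obtain ⟨v, hv, hgv⟩ := hg.exists_analyticAt hN0 hN γ
    refine ⟨N, hN0, u / v, hu.meromorphicAt.div hv.meromorphicAt, Eventually.of_forall fun τ => ?_⟩
    rw [hsmul, hfu, hgv, Pi.div_apply]

/-! ### The remainder term is a cusp form -/

theorem isBoundedAtImInfty_of_tendsto {f : ℍ → ℂ} {a : ℂ} (h : Tendsto f atImInfty (𝓝 a)) :
    IsBoundedAtImInfty f :=
  h.isBigO_one ℝ

theorem pow_slash (f : ℍ → ℂ) (n : ℕ) (γ : SL(2, ℤ)) :
    (f ^ n) ∣[(n : ℤ)] γ = (f ∣[(1 : ℤ)] γ) ^ n := by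
  induction n with
  | zero => simp only [pow_zero, Nat.cast_zero, ModularForm.is_invariant_one]
  | succ n ih => rw [pow_succ, pow_succ, Nat.cast_succ, ModularForm.mul_slash_SL2, ih]

theorem z_natCast_eq {p : ℕ} (hp : 0 < p) :
    (fun τ : ℍ => z p τ) = fun τ => z 1 (dilate ⟨p, hp⟩ τ) := by
  ext τ
  rw [show ((dilate ⟨p, hp⟩ τ : ℍ) : ℂ) = (p : ℂ) * τ from coe_dilate _ τ, z, z, Nat.cast_one,
    one_mul]

theorem levelChar_apply {p k : ℕ} {γ : SL(2, ℤ)}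
    (hγ : γ ∈ CongruenceSubgroup.Gamma0 (4 * p)) :
    levelChar p k ((γ 1 1 : ℤ) : ZMod (4 * p)) = chiInt (γ 1 1) ^ k := by
  have h10 : ((4 * p : ℕ) : ℤ) ∣ γ 1 0 := by
    rwa [CongruenceSubgroup.Gamma0_mem, ZMod.intCast_zmod_eq_zero_iff_dvd] at hγ
  have hcop : IsCoprime (γ 1 1) ((4 * p : ℕ) : ℤ) := by
    obtain ⟨c, hc⟩ := h10
    have hdet := det_eq_one γ
    rw [hc] at hdet
    exact ⟨γ 0 0, -(γ 0 1 * c), by linear_combination hdet⟩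
  rw [levelChar, ← ZMod.coe_unitOfIsCoprime _ hcop, MulChar.pow_apply_coe,
    ZMod.coe_unitOfIsCoprime, DirichletCharacter.changeLevel_eq_cast_of_dvd' _ _ hcop]
  rfl

/-- The remainder `z^{k-j} z_p^j - F`, where `F` is the Eisenstein part. -/
noncomputable def remainder (p k j : ℕ) (τ : ℍ) : ℂ :=
  z 1 τ ^ (k - j) * z p τ ^ j - (coeffOne p k j * F p k j 1 τ + coeffP p k j * F p k j p τ)

theorem mdifferentiable_remainder {p : ℕ} (hp : 0 < p) (k j : ℕ) : MDiff (remainder p k j) :=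
  mdifferentiable_of_differentiableOn
    (f := fun τ => z 1 τ ^ (k - j) * z p τ ^ j -
      (coeffOne p k j * F p k j 1 τ + coeffP p k j * F p k j p τ))
    ((((differentiableOn_z one_pos).pow _).mul ((differentiableOn_z hp).pow _)).sub
      (((differentiableOn_F p k j one_pos).const_mul _).add
        ((differentiableOn_F p k j hp).const_mul _)))

theorem exists_remainder_eq {p k j : ℕ} (hp : p.Prime) (hp2 : p ≠ 2) (hk : 1 < k) (hj : j ≤ k) :
    ∃ K₁ K₂ : ℍ → ℂ, LevelFour k 1 ((chi p : ℂ) ^ j * (-Complex.I / 2) ^ k) K₁ ∧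
      LevelFour k 1 ((chi p : ℂ) ^ (j + k) * (-Complex.I / 2) ^ k) K₂ ∧
      remainder p k j = (fun τ : ℍ => z 1 τ) ^ (k - j) *
        (fun τ : ℍ => z 1 (dilate ⟨p, hp.pos⟩ τ)) ^ j -
        (coeffOne p k j • K₁ + coeffP p k j • fun τ => K₂ (dilate ⟨p, hp.pos⟩ τ)) := by
  obtain ⟨K₁, K₂, h₁, h₂, h⟩ := (Nat.even_or_odd k).elim (eisenstein_part_even hp hp2 hk hj)
    (eisenstein_part_odd hp hk)
  refine ⟨K₁, K₂, h₁, h₂, funext fun τ => ?_⟩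
  rw [remainder, h, ← z_natCast_eq hp.pos]
  rfl

theorem remainder_slash_eq {k j : ℕ} (hj : j ≤ k) {c d : ℂ} {f g K L : ℍ → ℂ} (γ : SL(2, ℤ)) :
    (f ^ (k - j) * g ^ j - (c • K + d • L)) ∣[(k : ℤ)] γ =
      (f ∣[(1 : ℤ)] γ) ^ (k - j) * (g ∣[(1 : ℤ)] γ) ^ j -
        (c • (K ∣[(k : ℤ)] γ) + d • (L ∣[(k : ℤ)] γ)) := by
  rw [sub_eq_add_neg, SlashAction.add_slash, SlashAction.neg_slash, SlashAction.add_slash,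
    ModularForm.SL_smul_slash, ModularForm.SL_smul_slash, ← sub_eq_add_neg]
  congr 1
  have h := ModularForm.mul_slash_SL2 ((k - j : ℕ) : ℤ) j γ (f ^ (k - j)) (g ^ j)
  rwa [pow_slash, pow_slash, ← Nat.cast_add, Nat.sub_add_cancel hj] at h

/-- The relation between the coefficients that is needed at the cusps `a/c` with `p ∣ c`. -/
theorem coeffOne_add_coeffP {p k : ℕ} (hp : p.Prime) (hp2 : p ≠ 2) (hk : 1 < k) (j : ℕ) :
    coeffOne p k j + coeffP p k j = 1 := by
  have h0 := pChi_pow_sub_one_ne_zero hp hp2 hk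
  rw [coeffOne, coeffP]
  field_simp
  ring

/-- The relation between the coefficients that is needed at the cusps `a/c` with `p ∤ c`. -/
theorem coeffOne_add_coeffP_mul {p k j : ℕ} (hp : p.Prime) (hp2 : p ≠ 2) (hk : 1 < k) (hj : j ≤ k) :
    coeffOne p k j + coeffP p k j * ((chi p : ℂ) / p) ^ k = ((chi p : ℂ) / p) ^ j := by
  have h0 := pChi_pow_sub_one_ne_zero hp hp2 hk
  have hp0 : (p : ℂ) ≠ 0 := by exact_mod_cast hp.pos.ne'
  have hu : pChi p * ((chi p : ℂ) / p) = 1 := by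
    rw [pChi]
    field_simp
    exact chi_sq hp hp2
  generalize (chi p : ℂ) / p = u at *
  have hk1 : pChi p ^ k * u ^ k = 1 := by rw [← mul_pow, hu, one_pow]
  have hk2 : pChi p ^ (k - j) * u ^ k = u ^ j := by
    rw [← Nat.sub_add_cancel hj, Nat.add_sub_cancel, pow_add u, ← mul_assoc, ← mul_pow, hu, one_pow,
      one_mul]
  have hk3 : pChi p ^ k * u ^ j = pChi p ^ (k - j) := by
    rw [← Nat.sub_add_cancel hj, Nat.add_sub_cancel, pow_add (pChi p), mul_assoc, ← mul_pow, hu,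
      one_pow, mul_one]
  rw [coeffOne, coeffP, div_mul_eq_mul_div, ← add_div, div_eq_iff h0]
  linear_combination hk1 - hk2 - hk3

/-- At every cusp the values of `z^{k-j} z_p^j` and of the Eisenstein part agree. -/
theorem cuspVal_eq {p k j : ℕ} (hp : p.Prime) (hp2 : p ≠ 2) (hk : 1 < k) (hj : j ≤ k)
    (γ : SL(2, ℤ)) :
    cuspVal 1 1 (-Complex.I / 2) γ ^ (k - j) *
      (if (p : ℤ) ∣ γ 1 0 then cuspVal 1 1 (chiInt p ^ 1 * (-Complex.I / 2)) γ
        else cuspVal 1 ((chiInt p / p) ^ 1 * 1) (-Complex.I / 2 / p ^ 1) γ) ^ j =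
    coeffOne p k j * cuspVal k 1 ((chi p : ℂ) ^ j * (-Complex.I / 2) ^ k) γ +
      coeffP p k j * (if (p : ℤ) ∣ γ 1 0
        then cuspVal k 1 (chiInt p ^ k * ((chi p : ℂ) ^ (j + k) * (-Complex.I / 2) ^ k)) γ
        else cuspVal k ((chiInt p / p) ^ k * 1)
          ((chi p : ℂ) ^ (j + k) * (-Complex.I / 2) ^ k / p ^ k) γ) := by
  have h1 := coeffOne_add_coeffP hp hp2 hk j
  have h2 := coeffOne_add_coeffP_mul hp hp2 hk hj
  have hχ := chi_sq hp hp2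
  have hk' : ∀ x : ℂ, x ^ (k - j) * x ^ j = x ^ k := fun x => by
    rw [← pow_add, Nat.sub_add_cancel hj]
  have hχk : ((chi p : ℂ) ^ k) ^ 2 = 1 := by rw [← pow_mul, mul_comm, pow_mul, hχ, one_pow]
  have hχj : ((chi p : ℂ) ^ j) ^ 2 = 1 := by rw [← pow_mul, mul_comm, pow_mul, hχ, one_pow]
  rw [← chi_eq_chiInt]
  unfold cuspVal
  split_ifs
  · simp only [pow_one, mul_one, hk']
    linear_combination -(chiInt (γ 0 0) ^ k) * h1
  · simp only [pow_one, mul_one]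
    rw [mul_pow, ← mul_assoc, hk']
    linear_combination (-(chiInt (γ 0 0) ^ k)) * h2
  · generalize chiInt (γ 1 0) = x
    generalize -Complex.I / 2 = w
    rw [pow_one, pow_one, mul_left_comm x, mul_pow (chi p : ℂ), mul_left_comm, hk', mul_pow]
    linear_combination (-(x ^ k * w ^ k * (chi p : ℂ) ^ j)) * (h1 + coeffP p k j * hχk)
  · generalize chiInt (γ 1 0) = x
    generalize -Complex.I / 2 = w
    rw [div_pow, div_pow] at h2
    rw [pow_one, pow_one, ← mul_div_assoc, div_pow, ← mul_div_assoc, hk', mul_pow]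
    linear_combination (-(x ^ k * w ^ k * (chi p : ℂ) ^ j)) * h2 - (x ^ k * w ^ k / p ^ j) * hχj

theorem isZeroAtImInfty_remainder_slash {p k j : ℕ} (hp : p.Prime) (hp2 : p ≠ 2) (hk : 1 < k)
    (hj : j ≤ k) (γ : SL(2, ℤ)) : IsZeroAtImInfty (remainder p k j ∣[(k : ℤ)] γ) := by
  obtain ⟨K₁, K₂, h₁, h₂, h⟩ := exists_remainder_eq hp hp2 hk hj
  rw [h, remainder_slash_eq hj]
  have hz := levelFour_z.tendsto γ
  have hzp := levelFour_z.tendsto_dilate_prime (p := ⟨p, hp.pos⟩) hp hp2 γ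
  have hK := h₂.tendsto_dilate_prime (p := ⟨p, hp.pos⟩) hp hp2 γ
  have hlim := ((hz.pow (k - j)).mul (hzp.pow j)).sub
    (((h₁.tendsto γ).const_mul (coeffOne p k j)).add (hK.const_mul (coeffP p k j)))
  exact hlim.mono_right (congrArg 𝓝 (sub_eq_zero.mpr (cuspVal_eq hp hp2 hk hj γ))).le

theorem remainder_slash {p k j : ℕ} (hp : p.Prime) (hp2 : p ≠ 2) (hk : 1 < k)
    (hj : j ≤ k) {γ : SL(2, ℤ)} (hγ : ((4 * p : ℕ) : ℤ) ∣ γ 1 0) :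
    remainder p k j ∣[(k : ℤ)] γ = chiInt (γ 1 1) ^ k • remainder p k j := by
  obtain ⟨K₁, K₂, h₁, h₂, h⟩ := exists_remainder_eq hp hp2 hk hj
  have h4 : γ 1 0 % 4 = 0 := by
    obtain ⟨c, hc⟩ := hγ
    push_cast at hc
    rw [hc, mul_assoc]
    simp
  have hzp := levelFour_z.slash_dilate (p := ⟨p, hp.pos⟩) hγ
  have hK := h₂.slash_dilate (p := ⟨p, hp.pos⟩) hγ
  have hz := levelFour_z.slash γ h4
  rw [Nat.cast_one] at hz hzp
  rw [h, remainder_slash_eq hj, hz, hzp, hK, h₁.slash γ h4]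
  ext τ
  simp only [Pi.sub_apply, Pi.mul_apply, Pi.pow_apply, Pi.add_apply, Pi.smul_apply, smul_eq_mul,
    mul_pow, pow_one]
  have hk' : chiInt (γ 1 1) ^ (k - j) * chiInt (γ 1 1) ^ j = chiInt (γ 1 1) ^ k := by
    rw [← pow_add, Nat.sub_add_cancel hj]
  linear_combination (z 1 τ ^ (k - j) * z 1 (dilate ⟨p, hp.pos⟩ τ) ^ j) * hk'

theorem isHolomorphicForm_remainder {p k j : ℕ} (hp : p.Prime) (hp2 : p ≠ 2) (hk : 1 < k)
    (hj : j ≤ k) : IsHolomorphicForm (4 * p) k (remainder p k j) where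
  holo := mdifferentiable_remainder hp.pos k j
  slash _ hγ := remainder_slash hp hp2 hk hj hγ
  bounded γ := isBoundedAtImInfty_of_tendsto (isZeroAtImInfty_remainder_slash hp hp2 hk hj γ)

theorem isHolomorphicForm_z_pow (p k : ℕ) :
    IsHolomorphicForm (4 * p) k ((fun τ : ℍ => z 1 τ) ^ k) where
  holo := mdifferentiable_of_differentiableOn ((differentiableOn_z one_pos).pow k)
  slash γ hγ := by
    obtain ⟨c, hc⟩ := hγ
    have h := levelFour_z.slash γ (by rw [hc]; push_cast; rw [mul_assoc]; simp)
    rw [Nat.cast_one] at h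
    rw [pow_slash, h, pow_one, smul_pow]
  bounded γ := by
    rw [pow_slash]
    exact isBoundedAtImInfty_of_tendsto ((levelFour_z.tendsto γ).pow k)

theorem isCuspForm_remainder {p k j : ℕ} (hp : p.Prime) (hp2 : p ≠ 2) (hk : 1 < k)
    (hj : j ≤ k) : IsCuspForm (4 * p) (levelChar p k) k (remainder p k j) where
  holo := mdifferentiable_remainder hp.pos k j
  slash_eq γ hγ := by
    rw [levelChar_apply hγ]
    refine remainder_slash hp hp2 hk hj ?_
    rwa [CongruenceSubgroup.Gamma0_mem, ZMod.intCast_zmod_eq_zero_iff_dvd] at hγ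
  zero_at_cusps := isZeroAtImInfty_remainder_slash hp hp2 hk hj

end RamanujanMordell

theorem mainTheorem1 (p : ℕ) (hp : p.Prime) (hp2 : p ≠ 2) (k j : ℕ) (hk : 1 < k) (hj : j ≤ k) :
    (∃ A : ℍ → ℂ,
      RamanujanMordell.IsModularFunction (4 * p) A ∧
      RamanujanMordell.IsCuspForm (4 * p) (RamanujanMordell.levelChar p k) k
        (fun τ : ℍ => RamanujanMordell.z 1 (τ : ℂ) ^ k * A τ) ∧
      ∀ τ : ℍ,
        RamanujanMordell.z 1 (τ : ℂ) ^ (k - j) * RamanujanMordell.z p (τ : ℂ) ^ j =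
          (RamanujanMordell.pChi p ^ (k - j) - 1) / (RamanujanMordell.pChi p ^ k - 1) *
              RamanujanMordell.F p k j 1 (τ : ℂ)
            + (RamanujanMordell.pChi p ^ k - RamanujanMordell.pChi p ^ (k - j)) /
                (RamanujanMordell.pChi p ^ k - 1) * RamanujanMordell.F p k j p (τ : ℂ)
            + RamanujanMordell.z 1 (τ : ℂ) ^ k * A τ) ∧
    (∀ τ : ℍ,
      HasSum
        (fun n : ℕ => (RamanujanMordell.repNumber p (2 * (k - j)) (2 * j) n : ℂ) *
          RamanujanMordell.nome (τ : ℂ) ^ n)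
        (RamanujanMordell.z 1 (τ : ℂ) ^ (k - j) * RamanujanMordell.z p (τ : ℂ) ^ j)) := by
  have hfun : (fun τ : ℍ => RamanujanMordell.z 1 (τ : ℂ) ^ k *
      (RamanujanMordell.remainder p k j / (fun τ : ℍ => RamanujanMordell.z 1 (τ : ℂ)) ^ k) τ) =
      RamanujanMordell.remainder p k j := funext fun τ =>
    mul_div_cancel₀ _ (pow_ne_zero k (RamanujanMordell.z_ne_zero one_pos τ))
  refine ⟨⟨RamanujanMordell.remainder p k j / (fun τ : ℍ => RamanujanMordell.z 1 (τ : ℂ)) ^ k,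
    ?_, ?_, fun τ => ?_⟩, fun τ => RamanujanMordell.hasSum_repNumber hp.pos τ.im_pos _ _⟩
  · exact (RamanujanMordell.isHolomorphicForm_remainder hp hp2 hk hj).div
      (RamanujanMordell.isHolomorphicForm_z_pow p k) (Nat.mul_pos four_pos hp.pos)
      (Nat.dvd_mul_right 4 p) fun τ => pow_ne_zero k (RamanujanMordell.z_ne_zero one_pos τ)
  · rw [hfun]
    exact RamanujanMordell.isCuspForm_remainder hp hp2 hk hj
  · rw [congrFun hfun τ, RamanujanMordell.remainder, RamanujanMordell.coeffOne,
      RamanujanMordell.coeffP]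
    ring
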